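/- Let $n\ge 1$, $Q=2n+2$, $0<\lambda\le\Lambda<\infty$, $0<\delta<\tfrac12$, $\alpha=\frac{Q-2}{4}+\delta$, $\eta=2\sqrt{\Lambda/\lambda}+1$. On $\mathbb H^n=\mathbb R^{2n}\times\mathbb R$ with $J=\begin{pmatrix}0&-I_n\\ I_n&0\end{pmatrix}$ use the group law $(x,t)\circ(\xi,\tau)=(x+\xi,\,t+\tau+2\langle Jx,\xi\rangle)$, the norm $\rho(x,t)=(|x|^4+t^2)^{1/4}$, the distance $d(z,\zeta)=\rho(z^{-1}\circ\zeta)$ with its balls $B_R(z)$ and set distance $\mathrm{dist}$, the fields $X_i=\partial_{x_i}+2(Jx)_i\partial_t$ $(1\le i\le 2n)$, the horizontal Hessian $D^2_{\mathbb H}u=\big(\tfrac12(X_iX_ju+X_jX_iu)\big)_{i,j}$, and $\mathcal L_Au(z)=\mathrm{tr}(A(z)D^2_{\mathbb H}u(z))$. For $\Omega\subset\mathbb H^n$ open, $M_n(\lambda,\Lambda,\Omega)$ is the set of symmetric $2n\times 2n$ matrix functions $A$ with $\det A(z)=1$ and $\lambda I\le A(z)\le\Lambda I$ for $z\in\Omega$;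 $A$ is symplectic at $z$ if $A(z)^{-1}=J^tA(z)J$, and symplectic if this holds at every $z\in\Omega$. For a non-decreasing $\omega:[0,1)\to[0,1)$ with $\lim_{s\to0^+}\omega(s)=\omega(0)=0$, $C(\Omega,\omega)$ is the set of $A$ continuous on $\Omega$ with $\sup_{z\in B_\epsilon(z_0)\cap\Omega}\|A(z)-A(z_0)\|\le\omega(\epsilon)$ for all $z_0\in\Omega$, $0<\epsilon<1$ ($\|\cdot\|$ the Euclidean operator norm). For a constant positive definite matrix $M$ put $\phi_M(x,t)=\langle M^{-1}x,x\rangle^2+t^2$, $\rho_M=\phi_M^{1/4}$, $d_M(z,\zeta)=\rho_M(\zeta^{-1}\circ z)$ and $g_M=-\frac1\alpha\phi_M^{-\alpha}$ on $\mathbb H^n\setminus\{0\}$. Call $\epsilon_0>0$ admissible for $\omega$ if for every open $\Omega$, every $A\in M_n(\lambda,\Lambda,\Omega)\cap C(\Omega,\omega)$ and every $z_0\in\Omega$ at which $A$ is symplectic, with $M=A(z_0)$, $$-\mathrm{tr}\big(A(z)(D^2_{\mathbb H}g_M)(\zeta)\big)\ge0\qquad\text{for all }z\in B_{\epsilon_0}(z_0)\cap\Omega,\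 \zeta\ne0 .$$ There is a constant $C>0$ depending only on $\lambda,\Lambda,Q,\delta$ such that for every such $\omega$ an admissible $\epsilon_0$ exists and, for every admissible $\epsilon_0$, the following holds. Let $\Omega$ be open, $z_0\in\Omega$, $0<r\le\epsilon_0$ with $B_{\eta r}(z_0)\subseteq\Omega$, let $O',O$ be open with $O'\Subset O\subseteq B_r(z_0)$, and let $A\in M_n(\lambda,\Lambda,\Omega)\cap C(\Omega,\omega)$ be symplectic. Put $M=A(z_0)$ and $g=g_M$, let $\psi:\mathbb R\to\mathbb R$ be any smooth non-decreasing function with $\psi(s)=1$ for $s\ge2$ and $\psi(s)=0$ for $s<1$, and for $\mu>0$ let $$h_\mu(z)=\int_O\psi\Big(\frac{d_M(z,\zeta)}{\mu}\Big)\,g(z^{-1}\circ\zeta)\,d\zeta .$$ Then $h_\mu\in C^\infty(\mathbb H^n)$ for every $\mu>0$, and $$\mathcal L_Ah_\mu(z)\ \ge\ C\,r^{-4\delta}\qquad\text{for all }z\in O'\text{ and all }0<\mu<\min\Big\{\frac r{\sqrt\lambda},\ \frac{\mathrm{dist}(O',\partial O)}{2\sqrt\Lambda}\Big\}.$$ 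-/

import Mathlib

open MeasureTheory
open scoped Matrix ContDiff

noncomputable section

namespace Heisenberg

/-- The underlying space `ℝ²ⁿ × ℝ` of the Heisenberg group. The `2n` horizontal coordinates are
indexed by `Fin n ⊕ Fin n`, so that the matrix `[[0, -I], [I, 0]]` is `Matrix.J (Fin n) ℝ`.
Only its topology, smooth structure and Lebesgue measure are used (never the product norm). -/
abbrev Heis (n : ℕ) : Type := (Fin n ⊕ Fin n → ℝ) × ℝ

variable {n : ℕ}

/-- Group law `(x,t) ∘ (ξ,τ) = (x + ξ, t + τ + 2⟨J x, ξ⟩)`. -/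
def comp (z ζ : Heis n) : Heis n :=
  (z.1 + ζ.1, z.2 + ζ.2 + 2 * ((Matrix.J (Fin n) ℝ *ᵥ z.1) ⬝ᵥ ζ.1))

/-- Group inverse `(x,t)⁻¹ = (-x,-t)`. -/
def inv (z : Heis n) : Heis n := (-z.1, -z.2)

/-- The homogeneous norm `ρ(x,t) = (|x|⁴ + t²)^{1/4}`, with `|x|² = x ⬝ᵥ x`. -/
def rho (z : Heis n) : ℝ := ((z.1 ⬝ᵥ z.1) ^ 2 + z.2 ^ 2) ^ (1 / 4 : ℝ)

/-- The distance `d(z,ζ) = ρ(z⁻¹ ∘ ζ)`. -/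
def dist (z ζ : Heis n) : ℝ := rho (comp (inv z) ζ)

/-- The Korányi ball `B_R(z)`. -/
def ball (z : Heis n) (R : ℝ) : Set (Heis n) := {ζ | dist z ζ < R}

/-- The distance of two sets with respect to `d` (used for nonempty sets). -/
def setDist (S T : Set (Heis n)) : ℝ := sInf (Set.image2 dist S T)

/-- The vector field `X_i = ∂_{x_i} + 2 (J x)_i ∂_t`. -/
def X (i : Fin n ⊕ Fin n) (u : Heis n → ℝ) (z : Heis n) : ℝ :=
  fderiv ℝ u z (Pi.single i 1, 2 * (Matrix.J (Fin n) ℝ *ᵥ z.1) i)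

/-- The (symmetrized) horizontal Hessian. -/
def horizontalHessian (u : Heis n → ℝ) (z : Heis n) :
    Matrix (Fin n ⊕ Fin n) (Fin n ⊕ Fin n) ℝ :=
  Matrix.of fun i j => (X i (X j u) z + X j (X i u) z) / 2

/-- A matrix-valued function on the Heisenberg group. -/
abbrev Coeff (n : ℕ) : Type := Heis n → Matrix (Fin n ⊕ Fin n) (Fin n ⊕ Fin n) ℝ

/-- The operator `L_A u = tr(A D²_H u)`. -/
def L (A : Coeff n) (u : Heis n → ℝ) (z : Heis n) : ℝ :=
  (A z * horizontalHessian u z).trace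

/-- The class `M_n(λ, Λ, Ω)`: symmetric matrices of determinant one with
`λ I ≤ A(z) ≤ Λ I` for `z ∈ Ω`. -/
def IsElliptic (lam Lam : ℝ) (Ω : Set (Heis n)) (A : Coeff n) : Prop :=
  ∀ z ∈ Ω, (A z).IsSymm ∧ (A z).det = 1 ∧
    ∀ v : Fin n ⊕ Fin n → ℝ,
      lam * (v ⬝ᵥ v) ≤ v ⬝ᵥ (A z *ᵥ v) ∧ v ⬝ᵥ (A z *ᵥ v) ≤ Lam * (v ⬝ᵥ v)

/-- The symplectic condition for a constant matrix: `M⁻¹ = Jᵀ M J`. -/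
def IsSymplecticMatrix (M : Matrix (Fin n ⊕ Fin n) (Fin n ⊕ Fin n) ℝ) : Prop :=
  M⁻¹ = (Matrix.J (Fin n) ℝ)ᵀ * M * Matrix.J (Fin n) ℝ

/-- `A` is symplectic on `Ω`. -/
def IsSymplectic (Ω : Set (Heis n)) (A : Coeff n) : Prop := ∀ z ∈ Ω, IsSymplecticMatrix (A z)

/-- The modulus of continuity `ω_A(z₀; ε)`, the supremum over `z ∈ B_ε(z₀) ∩ Ω` of the Euclidean
operator norm of `A(z) - A(z₀)`, as a supremum in `[0, ∞]`. -/
def modulusOfContinuity (Ω : Set (Heis n)) (A : Coeff n) (z₀ : Heis n) (ε : ℝ) : ENNReal :=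
  ⨆ z ∈ ball z₀ ε ∩ Ω, ‖Matrix.toEuclideanCLM (𝕜 := ℝ) (A z - A z₀)‖ₑ

/-- `om : [0,1) → [0,1)` is non-decreasing with `lim_{s → 0+} om(s) = om(0) = 0`. -/
structure IsModulus (om : ℝ → ℝ) : Prop where
  mapsTo : Set.MapsTo om (Set.Ico 0 1) (Set.Ico 0 1)
  mono : MonotoneOn om (Set.Ico 0 1)
  zero : om 0 = 0
  tendsto : Filter.Tendsto om (nhdsWithin 0 (Set.Ioi 0)) (nhds 0)

/-- The class `C(Ω, om)`. -/
def HasModulus (Ω : Set (Heis n)) (om : ℝ → ℝ) (A : Coeff n) : Prop :=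
  ContinuousOn A Ω ∧ ∀ z₀ ∈ Ω, ∀ ε : ℝ, 0 < ε → ε < 1 →
    modulusOfContinuity Ω A z₀ ε ≤ ENNReal.ofReal (om ε)

/-- `φ_M(x,t) = ⟨M⁻¹ x, x⟩² + t²`. -/
def phiM (M : Matrix (Fin n ⊕ Fin n) (Fin n ⊕ Fin n) ℝ) (z : Heis n) : ℝ :=
  ((M⁻¹ *ᵥ z.1) ⬝ᵥ z.1) ^ 2 + z.2 ^ 2

/-- `ρ_M = φ_M^{1/4}`. -/
def rhoM (M : Matrix (Fin n ⊕ Fin n) (Fin n ⊕ Fin n) ℝ) (z : Heis n) : ℝ :=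
  phiM M z ^ (1 / 4 : ℝ)

/-- `d_M(z,ζ) = ρ_M(ζ⁻¹ ∘ z)`. -/
def distM (M : Matrix (Fin n ⊕ Fin n) (Fin n ⊕ Fin n) ℝ) (z ζ : Heis n) : ℝ :=
  rhoM M (comp (inv ζ) z)

/-- The homogeneous dimension `Q = 2n + 2`. -/
def Q (n : ℕ) : ℝ := 2 * n + 2

/-- `α = (Q - 2)/4 + δ`. -/
def alpha (n : ℕ) (δ : ℝ) : ℝ := (Q n - 2) / 4 + δ

/-- The kernel `g = -(1/α) φ_M^{-α}` (away from the origin). -/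
def kernel (δ : ℝ) (M : Matrix (Fin n ⊕ Fin n) (Fin n ⊕ Fin n) ℝ) (ζ : Heis n) : ℝ :=
  -(1 / alpha n δ) * phiM M ζ ^ (-alpha n δ)

/-- A cutoff profile: smooth, non-decreasing, `0` on `s < 1` and `1` on `s ≥ 2`. -/
structure IsCutoff (ψ : ℝ → ℝ) : Prop where
  smooth : ContDiff ℝ ∞ ψ
  mono : Monotone ψ
  eq_one : ∀ s, 2 ≤ s → ψ s = 1
  eq_zero : ∀ s, s < 1 → ψ s = 0

/-- `h_μ(z) = ∫_O ψ(d_M(z,ζ)/μ) g(z⁻¹ ∘ ζ) dζ`. -/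
def hmu (δ : ℝ) (M : Matrix (Fin n ⊕ Fin n) (Fin n ⊕ Fin n) ℝ) (ψ : ℝ → ℝ)
    (O : Set (Heis n)) (μ : ℝ) (z : Heis n) : ℝ :=
  ∫ ζ in O, ψ (distM M z ζ / μ) * kernel δ M (comp (inv z) ζ)

/-- `η = 2 √(Λ/λ) + 1`. -/
def eta (lam Lam : ℝ) : ℝ := 2 * √(Lam / lam) + 1

/-- The property that the radius `ε₀` is required to have: it is positive and, for every open
`Ω`, every `A ∈ M_n(λ, Λ, Ω) ∩ C(Ω, om)` and every `z₀ ∈ Ω` such that `M = A(z₀)` is symplectic,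
`-tr(A(z) D²_H g(ζ)) ≥ 0` for all `z ∈ B_{ε₀}(z₀) ∩ Ω` and all `ζ ≠ 0`. -/
def IsSubsolutionRadius (n : ℕ) (lam Lam δ : ℝ) (om : ℝ → ℝ) (ε₀ : ℝ) : Prop :=
  0 < ε₀ ∧ ∀ (Ω : Set (Heis n)) (A : Coeff n) (z₀ : Heis n),
    IsOpen Ω → IsElliptic lam Lam Ω A → HasModulus Ω om A → z₀ ∈ Ω →
    IsSymplecticMatrix (A z₀) →
    ∀ z ∈ ball z₀ ε₀ ∩ Ω, ∀ ζ : Heis n, ζ ≠ 0 →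
      0 ≤ -(A z * horizontalHessian (kernel δ (A z₀)) ζ).trace

end Heisenberg

end

/-! Let `k` be the kernel g_M multiplied by the cutoff at scale μ. Then `k` is smooth and h_μ(z) is
the integral of k(ζ⁻¹∘z) over O. The fields X_i are left invariant, so with A = A(z) frozen at the
point z, L_A h_μ(z) is the integral over O of T(ζ⁻¹∘z), where T = tr(A D²k).

The sign of T is unknown near the origin, where ψ acts. But for ζ outside O, ζ⁻¹∘z has gauge ρ_M >
2μ (`two_mul_lt_rhoM`), so there k = g_M and T ≤ 0 by admissibility. Take χ = step(φ_M/R⁴) with R =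
Kr so large that χ = 1 on all ζ⁻¹∘z with ζ in O. Replacing the indicator of O by χ only adds
nonpositive terms, hence L_A h_μ(z) ≥ ∫ χT over the whole group (`trace_hessian_hmu_ge`).

One integration by parts turns ∫ χT into -∫ ⟨A∇χ, ∇k⟩. Now ∇χ lives on R⁴ ≤ φ_M ≤ 2R⁴, where again k
= g_M, so μ and ψ have disappeared. Both gradients are multiples of ∇φ_M, with coefficients of
opposite sign, so the integrand is nonnegative; A ≥ (λ/Λ)M and the symplectic identity ⟨M∇φ_M, ∇φ_M⟩
= 16⟨M⁻¹x,x⟩φ_M bound it below (`integral_step_mul_trace_hessian_ge`). A linear change of variables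
evaluates the bound as R^(-4δ) times a positive number depending only on n and δ
(`integral_weight_phiM`, `gaugeConst_pos`).

Admissible radii exist because tr(M D²g_M) is negative with a margin proportional to δ, which
absorbs a small relative error between A(z) and M. -/

namespace Heisenberg

/-! ### Parametric integrals over a compact set. -/

section ParametricIntegral

variable {E F : Type*} [NormedAddCommGroup E] [NormedSpace ℝ E] [FiniteDimensional ℝ E]
  [NormedAddCommGroup F] [NormedSpace ℝ F] [SecondCountableTopology F]
  [MeasurableSpace F] [BorelSpace F]

theorem hasFDerivAt_integral_compact {G : Type*} [NormedAddCommGroup G] [NormedSpace ℝ G]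
    {ν : Measure F} [IsLocallyFiniteMeasure ν] {C : Set F} (hC : IsCompact C)
    {K : E × F → G} (hK : ContDiff ℝ 1 K) (x : E) :
    HasFDerivAt (fun x => ∫ y in C, K (x, y) ∂ν)
      (∫ y in C, (fderiv ℝ K (x, y)).comp (ContinuousLinearMap.inl ℝ E F) ∂ν) x := by
  have hK' : Continuous fun p : E × F =>
      (fderiv ℝ K p).comp (ContinuousLinearMap.inl ℝ E F) :=
    (hK.continuous_fderiv (by norm_num)).clm_comp continuous_const
  have hcomp : IsCompact (Metric.closedBall x 1 ×ˢ C) := (isCompact_closedBall x 1).prod hC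
  obtain ⟨c, hc⟩ := hcomp.exists_bound_of_continuousOn hK'.continuousOn
  have hfin : IsFiniteMeasure (ν.restrict C) :=
    ⟨by rw [Measure.restrict_apply_univ]; exact hC.measure_lt_top⟩
  refine hasFDerivAt_integral_of_dominated_of_fderiv_le (bound := fun _ => c)
    (F' := fun x y => (fderiv ℝ K (x, y)).comp (ContinuousLinearMap.inl ℝ E F))
    (Metric.closedBall_mem_nhds x one_pos) ?_ ?_ ?_ ?_ (integrable_const c) ?_
  · exact Filter.Eventually.of_forall fun x' =>
      (hK.continuous.comp (Continuous.prodMk_right x')).aestronglyMeasurable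
  · exact (hK.continuous.comp (Continuous.prodMk_right x)).continuousOn.integrableOn_compact hC
  · exact (hK'.comp (Continuous.prodMk_right x)).aestronglyMeasurable
  · exact (ae_restrict_iff' hC.measurableSet).2
      (Filter.Eventually.of_forall fun y hy x' hx' => hc (x', y) ⟨hx', hy⟩)
  · refine Filter.Eventually.of_forall fun y x' _ => ?_
    exact ((hK.differentiable (by norm_num)) (x', y)).hasFDerivAt.comp x'
      (hasFDerivAt_prodMk_left x' y)

end ParametricIntegral

/-- Induction on k: the derivative is a parametric integral of the same kind with values in `E →L[ℝ]
G`, so `G` has to vary inside the induction. -/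
theorem contDiff_integral_compact_nat {E F : Type} [NormedAddCommGroup E] [NormedSpace ℝ E]
    [FiniteDimensional ℝ E] [NormedAddCommGroup F] [NormedSpace ℝ F] [SecondCountableTopology F]
    [MeasurableSpace F] [BorelSpace F]
    {ν : Measure F} [IsLocallyFiniteMeasure ν] {C : Set F} (hC : IsCompact C) (k : ℕ) :
    ∀ {G : Type} [NormedAddCommGroup G] [NormedSpace ℝ G] {K : E × F → G}, ContDiff ℝ k K →
    ContDiff ℝ k (fun x => ∫ y in C, K (x, y) ∂ν) := by
  induction k with
  | zero =>
    intro G _ _ K hK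
    have : Continuous (Function.uncurry fun x y => K (x, y)) := by
      exact hK.continuous
    simpa using continuous_parametric_integral_of_continuous this hC
  | succ k ih =>
    intro G _ _ K hK
    push_cast at hK ⊢
    refine contDiff_succ_iff_hasFDerivAt.2 ⟨_, ih (K := fun p : E × F =>
      (fderiv ℝ K p).comp (ContinuousLinearMap.inl ℝ E F)) ?_, fun x =>
      hasFDerivAt_integral_compact hC (hK.of_le (by norm_num)) x⟩
    exact (hK.fderiv_right le_rfl).clm_comp contDiff_const

theorem contDiff_integral_compact {E F : Type} [NormedAddCommGroup E] [NormedSpace ℝ E]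
    [FiniteDimensional ℝ E] [NormedAddCommGroup F] [NormedSpace ℝ F] [SecondCountableTopology F]
    [MeasurableSpace F] [BorelSpace F]
    {ν : Measure F} [IsLocallyFiniteMeasure ν] {C : Set F} (hC : IsCompact C)
    {G : Type} [NormedAddCommGroup G] [NormedSpace ℝ G] {K : E × F → G} (hK : ContDiff ℝ ∞ K) :
    ContDiff ℝ ∞ (fun x => ∫ y in C, K (x, y) ∂ν) :=
  contDiff_infty.2 fun k => contDiff_integral_compact_nat hC k (contDiff_infty.1 hK k)

/-! ### Calculus of the horizontal fields and left invariance. -/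

variable {n : ℕ}

/-- The direction of the field `X i` at the point `z`. -/
def frame (i : Fin n ⊕ Fin n) (z : Heis n) : Heis n :=
  (Pi.single i 1, 2 * (Matrix.J (Fin n) ℝ *ᵥ z.1) i)

theorem X_eq (i : Fin n ⊕ Fin n) (u : Heis n → ℝ) (z : Heis n) :
    X i u z = fderiv ℝ u z (frame i z) := rfl

theorem dotProduct_J_mulVec_self (x : Fin n ⊕ Fin n → ℝ) :
    x ⬝ᵥ (Matrix.J (Fin n) ℝ *ᵥ x) = 0 := by
  have h : x ⬝ᵥ (Matrix.J (Fin n) ℝ *ᵥ x) = -(x ⬝ᵥ (Matrix.J (Fin n) ℝ *ᵥ x)) := by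
    conv_lhs => rw [Matrix.dotProduct_mulVec, ← Matrix.mulVec_transpose, Matrix.J_transpose,
      Matrix.neg_mulVec, neg_dotProduct, dotProduct_comm]
  linarith

theorem J_mulVec_dotProduct_J_mulVec (x y : Fin n ⊕ Fin n → ℝ) :
    (Matrix.J (Fin n) ℝ *ᵥ x) ⬝ᵥ (Matrix.J (Fin n) ℝ *ᵥ y) = x ⬝ᵥ y := by
  rw [Matrix.dotProduct_mulVec, ← Matrix.mulVec_transpose, Matrix.J_transpose,
    Matrix.mulVec_mulVec, Matrix.neg_mul, Matrix.J_squared]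
  simp

theorem contDiff_mulVec (N : Matrix (Fin n ⊕ Fin n) (Fin n ⊕ Fin n) ℝ) (i : Fin n ⊕ Fin n)
    {k : WithTop ℕ∞} : ContDiff ℝ k fun z : Heis n => (N *ᵥ z.1) i := by
  simp only [Matrix.mulVec, dotProduct]
  fun_prop

theorem contDiff_frame (i : Fin n ⊕ Fin n) {k : WithTop ℕ∞} :
    ContDiff ℝ k (frame (n := n) i) :=
  contDiff_const.prodMk (contDiff_const.mul (contDiff_mulVec _ i))

theorem contDiff_X {u : Heis n → ℝ} {k m : WithTop ℕ∞} (hu : ContDiff ℝ k u) (hm : m + 1 ≤ k)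
    (i : Fin n ⊕ Fin n) : ContDiff ℝ m (X i u) :=
  (hu.fderiv_right hm).clm_apply (contDiff_frame i)

theorem X_congr {u v : Heis n → ℝ} {z : Heis n} (h : u =ᶠ[nhds z] v) (i : Fin n ⊕ Fin n) :
    X i u z = X i v z := by
  rw [X_eq, X_eq, h.fderiv_eq]

theorem X_congr_nhds {u v : Heis n → ℝ} {z : Heis n} (h : u =ᶠ[nhds z] v) (i : Fin n ⊕ Fin n) :
    X i u =ᶠ[nhds z] X i v :=
  h.eventually_nhds.mono fun _ hy => X_congr hy i

theorem horizontalHessian_congr {u v : Heis n → ℝ} {z : Heis n} (h : u =ᶠ[nhds z] v) :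
    horizontalHessian u z = horizontalHessian v z := by
  ext i j
  simp only [horizontalHessian, Matrix.of_apply]
  rw [X_congr (X_congr_nhds h j) i, X_congr (X_congr_nhds h i) j]

theorem X_mul {u v : Heis n → ℝ} {z : Heis n} (hu : DifferentiableAt ℝ u z)
    (hv : DifferentiableAt ℝ v z) (i : Fin n ⊕ Fin n) :
    X i (fun w => u w * v w) z = u z * X i v z + v z * X i u z := by
  simp only [X_eq]
  rw [fderiv_fun_mul hu hv]
  simp

theorem X_comp {f : ℝ → ℝ} {f' : ℝ} {u : Heis n → ℝ} {z : Heis n} (hf : HasDerivAt f f' (u z))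
    (hu : DifferentiableAt ℝ u z) (i : Fin n ⊕ Fin n) :
    X i (fun w => f (u w)) z = f' * X i u z := by
  have h : HasFDerivAt (fun w => f (u w)) (f' • fderiv ℝ u z) z :=
    hf.comp_hasFDerivAt z hu.hasFDerivAt
  rw [X_eq, h.fderiv]
  rfl

theorem X_eq_of_hasDerivAt {u : Heis n → ℝ} {z : Heis n} {i : Fin n ⊕ Fin n} {c : ℝ}
    (hu : DifferentiableAt ℝ u z) (h : HasDerivAt (fun s : ℝ => u (z + s • frame i z)) c 0) :
    X i u z = c := by
  rw [X_eq, ← hu.lineDeriv_eq_fderiv]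
  exact h.deriv

theorem contDiff_comp_inv {k : WithTop ℕ∞} :
    ContDiff ℝ k fun p : Heis n × Heis n => comp (inv p.2) p.1 := by
  simp only [comp, inv, Matrix.mulVec, dotProduct]
  fun_prop

/-- The fields `X i` are left invariant. -/
theorem X_comp_inv {u : Heis n → ℝ} {z ζ : Heis n}
    (hu : DifferentiableAt ℝ u (comp (inv ζ) z)) (i : Fin n ⊕ Fin n) :
    X i (fun w => u (comp (inv ζ) w)) z = X i u (comp (inv ζ) z) := by
  have hd : Differentiable ℝ fun w : Heis n => comp (inv ζ) w :=
    ((contDiff_comp_inv (k := 1)).comp (contDiff_prodMk_left ζ)).differentiable (by norm_num)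
  -- Left translation is affine and carries the straight line through z directed by the frame to the
  -- one at the image point.
  have hline : ∀ s : ℝ, comp (inv ζ) (z + s • frame i z)
      = comp (inv ζ) z + s • frame i (comp (inv ζ) z) := by
    intro s
    ext k
    · simp [comp, inv, frame, add_assoc]
    · simp [comp, inv, frame, Matrix.mulVec_neg, Matrix.mulVec_add]
      ring
  refine X_eq_of_hasDerivAt (hu.comp z (hd z)) ?_
  simp only [hline]
  exact hu.hasFDerivAt.hasLineDerivAt _

/-! ### Invariance of Lebesgue measure and integration of the horizontal fields. -/

theorem comp_inv_eq (z ζ : Heis n) : comp (inv ζ) z =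
    (z.1 - ζ.1, z.2 - ζ.2 - 2 * ((Matrix.J (Fin n) ℝ *ᵥ ζ.1) ⬝ᵥ z.1)) := by
  ext k
  · simp [comp, inv]; ring
  · simp [comp, inv, Matrix.mulVec_neg]; ring

/-- The map is a reflection and translation in x followed, for each fixed x, by one in t: a skew
product of measure preserving maps. -/
theorem measurePreserving_comp_inv (z : Heis n) :
    MeasurePreserving (fun ζ : Heis n => comp (inv ζ) z) volume volume := by
  have h : (fun ζ : Heis n => comp (inv ζ) z) = fun ζ : Heis n =>
      (z.1 - ζ.1, (z.2 - 2 * ((Matrix.J (Fin n) ℝ *ᵥ ζ.1) ⬝ᵥ z.1)) - ζ.2) := by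
    funext ζ
    rw [comp_inv_eq]
    ext k
    · rfl
    · simp; ring
  rw [h]
  have hm : Measurable (Function.uncurry fun (x : Fin n ⊕ Fin n → ℝ) (t : ℝ) =>
      (z.2 - 2 * ((Matrix.J (Fin n) ℝ *ᵥ x) ⬝ᵥ z.1)) - t) := by
    refine Continuous.measurable ?_
    simp only [Matrix.mulVec, dotProduct]
    fun_prop
  exact (Measure.measurePreserving_sub_left volume z.1).skew_product hm
    (Filter.Eventually.of_forall fun x => (Measure.measurePreserving_sub_left volume _).map_eq)

theorem integral_comp_inv {f : Heis n → ℝ} (hf : Continuous f) (z : Heis n) :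
    ∫ ζ, f (comp (inv ζ) z) = ∫ w, f w := by
  have h := measurePreserving_comp_inv z
  conv_rhs => rw [← h.map_eq]
  exact (integral_map h.measurable.aemeasurable hf.aestronglyMeasurable).symm

/-- The fields `X i` are divergence free. -/
instance isAddHaarMeasure_volume : (volume : Measure (Heis n)).IsAddHaarMeasure :=
  Measure.prod.instIsAddHaarMeasure volume volume

theorem integral_mul_fderiv_eq_zero {c f : Heis n → ℝ} {v : Heis n} (hcs : ContDiff ℝ 1 c)
    (hcv : ∀ z, fderiv ℝ c z v = 0) (hf : ContDiff ℝ 1 f) (hc : HasCompactSupport f) :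
    ∫ z, c z * fderiv ℝ f z v = 0 := by
  have hf' : Continuous fun z => fderiv ℝ f z v :=
    (hf.continuous_fderiv (by norm_num)).clm_apply continuous_const
  rw [integral_mul_fderiv_eq_neg_fderiv_mul_of_integrable]
  · simp [hcv]
  · simp [hcv]
  · exact (hcs.continuous.mul hf').integrable_of_hasCompactSupport (hc.fderiv_apply ℝ v).mul_left
  · exact (hcs.continuous.mul hf.continuous).integrable_of_hasCompactSupport hc.mul_left
  · exact fun z _ => hcs.differentiable (by norm_num) z
  · exact fun z _ => hf.differentiable (by norm_num) z

/-- The coefficient of ∂_t in X_i does not depend on t, so both summands of X_i f are exact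
derivatives of compactly supported functions. -/
theorem integral_X_eq_zero {f : Heis n → ℝ} (hf : ContDiff ℝ 1 f) (hc : HasCompactSupport f)
    (i : Fin n ⊕ Fin n) : ∫ z, X i f z = 0 := by
  set c : Heis n → ℝ := fun z => 2 * (Matrix.J (Fin n) ℝ *ᵥ z.1) i
  have hcs : ContDiff ℝ 1 c := contDiff_const.mul (contDiff_mulVec _ i)
  have hcv : ∀ z, fderiv ℝ c z (0, 1) = 0 := fun z => by
    rw [← (hcs.differentiable (by norm_num) z).lineDeriv_eq_fderiv]
    simp [lineDeriv, c]
  have hX : ∀ z, X i f z = 1 * fderiv ℝ f z (Pi.single i 1, 0) + c z * fderiv ℝ f z (0, 1) := by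
    intro z
    have : frame i z = (1 : ℝ) • (Pi.single i (1 : ℝ), (0 : ℝ)) + c z • (0, (1 : ℝ)) := by
      simp [frame, c]
    rw [X_eq, this, map_add, map_smul, map_smul]
    rfl
  have hf' : ∀ v : Heis n, Continuous fun z => fderiv ℝ f z v := fun v =>
    (hf.continuous_fderiv (by norm_num)).clm_apply continuous_const
  simp only [hX]
  rw [integral_add, integral_mul_fderiv_eq_zero contDiff_const (by simp) hf hc,
    integral_mul_fderiv_eq_zero hcs hcv hf hc, add_zero]
  · exact (continuous_const.mul (hf' _)).integrable_of_hasCompactSupport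
      (hc.fderiv_apply ℝ _).mul_left
  · exact (hcs.continuous.mul (hf' _)).integrable_of_hasCompactSupport
      (hc.fderiv_apply ℝ _).mul_left

theorem X_integral {ν : Measure (Heis n)} [IsLocallyFiniteMeasure ν] {C : Set (Heis n)}
    (hC : IsCompact C) {k : Heis n → ℝ} (hk : ContDiff ℝ 1 k) (i : Fin n ⊕ Fin n) (z : Heis n) :
    X i (fun z => ∫ ζ in C, k (comp (inv ζ) z) ∂ν) z
      = ∫ ζ in C, X i k (comp (inv ζ) z) ∂ν := by
  have hK : ContDiff ℝ 1 fun p : Heis n × Heis n => k (comp (inv p.2) p.1) :=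
    hk.comp contDiff_comp_inv
  have h := hasFDerivAt_integral_compact (ν := ν) hC hK z
  rw [X_eq, h.fderiv, ContinuousLinearMap.integral_apply]
  · refine integral_congr_ae (Filter.Eventually.of_forall fun ζ => ?_)
    have h1 : HasFDerivAt (fun w => k (comp (inv ζ) w))
        ((fderiv ℝ (fun p : Heis n × Heis n => k (comp (inv p.2) p.1)) (z, ζ)).comp
          (ContinuousLinearMap.inl ℝ (Heis n) (Heis n))) z :=
      HasFDerivAt.comp (g := fun p : Heis n × Heis n => k (comp (inv p.2) p.1))
        (f := fun w => (w, ζ)) z ((hK.differentiable (by norm_num)) (z, ζ)).hasFDerivAt (hasFDerivAt_prodMk_left z ζ)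
    simp only
    rw [← X_comp_inv (hk.differentiable (by norm_num) _), X_eq, h1.fderiv]
  · refine ContinuousOn.integrableOn_compact hC (Continuous.continuousOn ?_)
    exact ((hK.continuous_fderiv (by norm_num)).comp (Continuous.prodMk_right z)).clm_comp
      continuous_const

end Heisenberg

/-! ### Constant elliptic symplectic matrices and the form of M⁻¹. -/

namespace Heisenberg

/-- A constant matrix in the class `M_n(λ, Λ)`. -/
structure IsEllipticMatrix {n : ℕ} (lam Lam : ℝ)
    (M : Matrix (Fin n ⊕ Fin n) (Fin n ⊕ Fin n) ℝ) : Prop where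
  isSymm : M.IsSymm
  det_eq : M.det = 1
  lower : ∀ v, lam * (v ⬝ᵥ v) ≤ v ⬝ᵥ (M *ᵥ v)
  upper : ∀ v, v ⬝ᵥ (M *ᵥ v) ≤ Lam * (v ⬝ᵥ v)

theorem IsElliptic.isEllipticMatrix {n : ℕ} {lam Lam : ℝ} {Ω : Set (Heis n)} {A : Coeff n}
    (h : IsElliptic lam Lam Ω A) {z : Heis n} (hz : z ∈ Ω) : IsEllipticMatrix lam Lam (A z) :=
  ⟨(h z hz).1, (h z hz).2.1, fun v => ((h z hz).2.2 v).1, fun v => ((h z hz).2.2 v).2⟩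

variable {n : ℕ} {lam Lam : ℝ} {M : Matrix (Fin n ⊕ Fin n) (Fin n ⊕ Fin n) ℝ}

theorem dotProduct_self_nonneg' (v : Fin n ⊕ Fin n → ℝ) : 0 ≤ v ⬝ᵥ v :=
  Finset.sum_nonneg fun i _ => mul_self_nonneg (v i)

theorem dotProduct_self_pos {v : Fin n ⊕ Fin n → ℝ} (hv : v ≠ 0) : 0 < v ⬝ᵥ v :=
  lt_of_le_of_ne (dotProduct_self_nonneg' v) fun h => hv (dotProduct_self_eq_zero.1 h.symm)

namespace IsEllipticMatrix

theorem mul_inv (hM : IsEllipticMatrix lam Lam M) : M * M⁻¹ = 1 :=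
  Matrix.mul_nonsing_inv M (by simp [hM.det_eq])

theorem inv_isSymm (hM : IsEllipticMatrix lam Lam M) : (M⁻¹).IsSymm := by
  rw [Matrix.IsSymm, Matrix.transpose_nonsing_inv, hM.isSymm.eq]

theorem exists_factor (hM : IsEllipticMatrix lam Lam M) (hlam : 0 < lam) :
    ∃ B : Matrix (Fin n ⊕ Fin n) (Fin n ⊕ Fin n) ℝ, M = Bᵀ * B := by
  have hpos : M.PosSemidef := .of_dotProduct_mulVec_nonneg
    (by rw [Matrix.IsHermitian, Matrix.conjTranspose_eq_transpose_of_trivial, hM.isSymm.eq])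
    fun v => by
      simpa using (mul_nonneg hlam.le (dotProduct_self_nonneg' v)).trans (hM.lower v)
  open scoped MatrixOrder in
  obtain ⟨B, hB⟩ := CStarAlgebra.nonneg_iff_eq_star_mul_self.mp hpos.nonneg
  exact ⟨B, by simpa [Matrix.star_eq_conjTranspose] using hB⟩

theorem mulVec_inv_mulVec (hM : IsEllipticMatrix lam Lam M) (x : Fin n ⊕ Fin n → ℝ) :
    M *ᵥ (M⁻¹ *ᵥ x) = x := by
  rw [Matrix.mulVec_mulVec, hM.mul_inv, Matrix.one_mulVec]

/-- The quadratic form of `M⁻¹`, computed with the symplectic condition. -/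
theorem inv_form_eq (hS : IsSymplecticMatrix M) (x : Fin n ⊕ Fin n → ℝ) :
    (M⁻¹ *ᵥ x) ⬝ᵥ x =
      (Matrix.J (Fin n) ℝ *ᵥ x) ⬝ᵥ (M *ᵥ (Matrix.J (Fin n) ℝ *ᵥ x)) := by
  rw [hS, ← Matrix.mulVec_mulVec, ← Matrix.mulVec_mulVec, Matrix.mulVec_transpose,
    ← Matrix.dotProduct_mulVec, dotProduct_comm]

theorem inv_form_lower (hM : IsEllipticMatrix lam Lam M) (hS : IsSymplecticMatrix M)
    (x : Fin n ⊕ Fin n → ℝ) : lam * (x ⬝ᵥ x) ≤ (M⁻¹ *ᵥ x) ⬝ᵥ x := by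
  rw [inv_form_eq hS, ← J_mulVec_dotProduct_J_mulVec x x]
  exact hM.lower _

theorem inv_form_nonneg (hM : IsEllipticMatrix lam Lam M) (hlam : 0 < lam)
    (hS : IsSymplecticMatrix M) (x : Fin n ⊕ Fin n → ℝ) : 0 ≤ (M⁻¹ *ᵥ x) ⬝ᵥ x :=
  (mul_nonneg hlam.le (dotProduct_self_nonneg' x)).trans (hM.inv_form_lower hS x)

theorem inv_form_upper (hM : IsEllipticMatrix lam Lam M) (hS : IsSymplecticMatrix M)
    (x : Fin n ⊕ Fin n → ℝ) : (M⁻¹ *ᵥ x) ⬝ᵥ x ≤ Lam * (x ⬝ᵥ x) := by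
  rw [inv_form_eq hS, ← J_mulVec_dotProduct_J_mulVec x x]
  exact hM.upper _

theorem dotProduct_mulVec_comm (hM : M.IsSymm) (x y : Fin n ⊕ Fin n → ℝ) :
    x ⬝ᵥ (M *ᵥ y) = y ⬝ᵥ (M *ᵥ x) := by
  rw [Matrix.dotProduct_mulVec, ← Matrix.mulVec_transpose, hM.eq, dotProduct_comm]

theorem dotProduct_sq_le (x y : Fin n ⊕ Fin n → ℝ) : (x ⬝ᵥ y) ^ 2 ≤ (x ⬝ᵥ x) * (y ⬝ᵥ y) := by
  have h := Finset.sum_mul_sq_le_sq_mul_sq Finset.univ x y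
  simpa [dotProduct, sq] using h

/-- Lower bound for the form of `M⁻¹` from the upper bound for that of `M`. -/
theorem dotProduct_self_le (hM : IsEllipticMatrix lam Lam M) (hlam : 0 < lam)
    (hS : IsSymplecticMatrix M) (x : Fin n ⊕ Fin n → ℝ) :
    x ⬝ᵥ x ≤ Lam * ((M⁻¹ *ᵥ x) ⬝ᵥ x) := by
  rcases eq_or_ne x 0 with rfl | hx
  · simp
  have hpos := dotProduct_self_pos hx
  obtain ⟨B, hB⟩ := hM.exists_factor hlam
  have hBB : ∀ v w, v ⬝ᵥ (M *ᵥ w) = (B *ᵥ v) ⬝ᵥ (B *ᵥ w) := fun v w => by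
    rw [hB, ← Matrix.mulVec_mulVec, Matrix.mulVec_transpose, dotProduct_comm,
      ← Matrix.dotProduct_mulVec, dotProduct_comm]
  -- Cauchy–Schwarz for the inner product of M, applied to x and M⁻¹x: |x|⁴ ≤ ⟨x,Mx⟩⟨M⁻¹x,x⟩.
  have h := dotProduct_sq_le (B *ᵥ x) (B *ᵥ (M⁻¹ *ᵥ x))
  rw [← hBB, ← hBB, ← hBB, hM.mulVec_inv_mulVec] at h
  have hq := hM.inv_form_nonneg hlam hS x
  have hu := hM.upper x
  have h2 : (x ⬝ᵥ x) * (x ⬝ᵥ x) ≤ (x ⬝ᵥ x) * (Lam * ((M⁻¹ *ᵥ x) ⬝ᵥ x)) := by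
    nlinarith [mul_le_mul_of_nonneg_right hu hq]
  exact le_of_mul_le_mul_left h2 hpos

theorem one_le (hn : 1 ≤ n) (hM : IsEllipticMatrix lam Lam M) (hlam : 0 < lam)
    (hLam : lam ≤ Lam) (hS : IsSymplecticMatrix M) : 1 ≤ Lam := by
  set x : Fin n ⊕ Fin n → ℝ := Pi.single (Sum.inl ⟨0, hn⟩) 1
  have hx : x ⬝ᵥ x = 1 := by simp [x]
  have h1 := hM.dotProduct_self_le hlam hS x
  have h2 := hM.inv_form_upper hS x
  rw [hx] at h1 h2
  nlinarith

end IsEllipticMatrix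

/-! ### Horizontal derivatives of φ_M and of the kernel g_M. -/

/-- The horizontal gradient of `φ_M`. -/
noncomputable def gradPhi (M : Matrix (Fin n ⊕ Fin n) (Fin n ⊕ Fin n) ℝ) (z : Heis n) : Fin n ⊕ Fin n → ℝ :=
  (4 * ((M⁻¹ *ᵥ z.1) ⬝ᵥ z.1)) • (M⁻¹ *ᵥ z.1) + (4 * z.2) • (Matrix.J (Fin n) ℝ *ᵥ z.1)

/-- The horizontal Hessian of `φ_M`. -/
noncomputable def hessPhi (M : Matrix (Fin n ⊕ Fin n) (Fin n ⊕ Fin n) ℝ) (z : Heis n) :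
    Matrix (Fin n ⊕ Fin n) (Fin n ⊕ Fin n) ℝ :=
  (8 : ℝ) • Matrix.vecMulVec (M⁻¹ *ᵥ z.1) (M⁻¹ *ᵥ z.1) +
    (4 * ((M⁻¹ *ᵥ z.1) ⬝ᵥ z.1)) • M⁻¹ +
    (8 : ℝ) • Matrix.vecMulVec (Matrix.J (Fin n) ℝ *ᵥ z.1) (Matrix.J (Fin n) ℝ *ᵥ z.1)

theorem contDiff_inv_form {k : WithTop ℕ∞} :
    ContDiff ℝ k fun z : Heis n => (M⁻¹ *ᵥ z.1) ⬝ᵥ z.1 := by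
  simp only [Matrix.mulVec, dotProduct]
  fun_prop

theorem contDiff_phiM {k : WithTop ℕ∞} : ContDiff ℝ k (phiM M) :=
  (contDiff_inv_form.pow 2).add (contDiff_snd.pow 2)

theorem contDiff_gradPhi (j : Fin n ⊕ Fin n) {k : WithTop ℕ∞} :
    ContDiff ℝ k fun z => gradPhi M z j :=
  ((contDiff_const.mul contDiff_inv_form).mul (contDiff_mulVec _ j)).add
    ((contDiff_const.mul contDiff_snd).mul (contDiff_mulVec _ j))

theorem phiM_nonneg (z : Heis n) : 0 ≤ phiM M z := by unfold phiM; positivity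

theorem phiM_zero : phiM M (0 : Heis n) = 0 := by simp [phiM]

theorem phiM_neg (z : Heis n) : phiM M (-z) = phiM M z := by
  simp [phiM, Matrix.mulVec_neg]

theorem phiM_pos (hM : IsEllipticMatrix lam Lam M) (hlam : 0 < lam) (hS : IsSymplecticMatrix M)
    {z : Heis n} (hz : z ≠ 0) : 0 < phiM M z := by
  unfold phiM
  rcases eq_or_ne z.1 0 with h | h
  · have : z.2 ≠ 0 := fun h2 => hz (Prod.ext h h2)
    positivity
  · have := (mul_pos hlam (dotProduct_self_pos h)).trans_le (hM.inv_form_lower hS z.1)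
    positivity

theorem inv_form_line (hN : (M⁻¹).IsSymm) (z : Heis n) (i : Fin n ⊕ Fin n) (s : ℝ) :
    (M⁻¹ *ᵥ (z + s • frame i z).1) ⬝ᵥ (z + s • frame i z).1 =
      (M⁻¹ *ᵥ z.1) ⬝ᵥ z.1 + s * (2 * (M⁻¹ *ᵥ z.1) i) + s ^ 2 * M⁻¹ i i := by
  have h : (M⁻¹ *ᵥ Pi.single i 1) ⬝ᵥ z.1 = (M⁻¹ *ᵥ z.1) i := by
    rw [dotProduct_comm, IsEllipticMatrix.dotProduct_mulVec_comm hN, single_one_dotProduct]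
  simp only [frame, Prod.fst_add, Prod.smul_fst, Matrix.mulVec_add, Matrix.mulVec_smul,
    add_dotProduct, dotProduct_add, smul_dotProduct, dotProduct_smul, h, smul_eq_mul,
    dotProduct_single_one]
  simp
  ring

theorem X_inv_form (hN : (M⁻¹).IsSymm) (i : Fin n ⊕ Fin n) (z : Heis n) :
    X i (fun z : Heis n => (M⁻¹ *ᵥ z.1) ⬝ᵥ z.1) z = 2 * (M⁻¹ *ᵥ z.1) i := by
  refine X_eq_of_hasDerivAt ((contDiff_inv_form (k := 1)).differentiable (by norm_num) z) ?_
  simp only [inv_form_line hN]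
  have h := (((hasDerivAt_id' (0 : ℝ)).mul_const (2 * (M⁻¹ *ᵥ z.1) i)).const_add
    ((M⁻¹ *ᵥ z.1) ⬝ᵥ z.1)).fun_add (((hasDerivAt_id' (0 : ℝ)).fun_pow 2).mul_const (M⁻¹ i i))
  simpa using h

theorem X_mulVec (N : Matrix (Fin n ⊕ Fin n) (Fin n ⊕ Fin n) ℝ) (i j : Fin n ⊕ Fin n)
    (z : Heis n) : X i (fun z : Heis n => (N *ᵥ z.1) j) z = N j i := by
  refine X_eq_of_hasDerivAt ((contDiff_mulVec N j (k := 1)).differentiable (by norm_num) z) ?_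
  have h := ((hasDerivAt_id' (0 : ℝ)).mul_const (N j i)).const_add ((N *ᵥ z.1) j)
  simpa [frame, Matrix.mulVec_add, Matrix.mulVec_smul] using h

theorem X_snd (i : Fin n ⊕ Fin n) (z : Heis n) :
    X i (fun z : Heis n => z.2) z = 2 * (Matrix.J (Fin n) ℝ *ᵥ z.1) i := by
  rw [X_eq, hasFDerivAt_snd.fderiv]
  rfl

theorem X_add {u v : Heis n → ℝ} {z : Heis n} (hu : DifferentiableAt ℝ u z)
    (hv : DifferentiableAt ℝ v z) (i : Fin n ⊕ Fin n) :
    X i (fun w => u w + v w) z = X i u z + X i v z := by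
  simp only [X_eq]
  rw [fderiv_fun_add hu hv]
  rfl

theorem X_const_mul {u : Heis n → ℝ} {z : Heis n} (hu : DifferentiableAt ℝ u z) (c : ℝ)
    (i : Fin n ⊕ Fin n) : X i (fun w => c * u w) z = c * X i u z := by
  simp only [X_eq]
  rw [fderiv_const_mul hu]
  rfl

theorem X_phiM (hN : (M⁻¹).IsSymm) (i : Fin n ⊕ Fin n) (z : Heis n) :
    X i (phiM M) z = gradPhi M z i := by
  have hd : DifferentiableAt ℝ (fun z : Heis n => (M⁻¹ *ᵥ z.1) ⬝ᵥ z.1) z :=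
    (contDiff_inv_form (k := 1)).differentiable (by norm_num) z
  have hp : phiM M = fun z : Heis n => ((M⁻¹ *ᵥ z.1) ⬝ᵥ z.1) * ((M⁻¹ *ᵥ z.1) ⬝ᵥ z.1) +
      z.2 * z.2 := by
    funext z; simp only [phiM, sq]
  rw [hp, X_add (hd.fun_mul hd) (by fun_prop), X_mul hd hd,
    X_mul differentiableAt_snd differentiableAt_snd, X_inv_form hN, X_snd]
  simp [gradPhi]
  ring

/-- The term 4tJ is the commutator part; it is antisymmetric and drops out of the symmetrized
Hessian. -/
theorem X_gradPhi (hN : (M⁻¹).IsSymm) (i j : Fin n ⊕ Fin n) (z : Heis n) :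
    X i (fun w => gradPhi M w j) z =
      hessPhi M z i j + 4 * z.2 * Matrix.J (Fin n) ℝ j i := by
  have hd : DifferentiableAt ℝ (fun z : Heis n => (M⁻¹ *ᵥ z.1) ⬝ᵥ z.1) z :=
    (contDiff_inv_form (k := 1)).differentiable (by norm_num) z
  have hd' : ∀ N : Matrix (Fin n ⊕ Fin n) (Fin n ⊕ Fin n) ℝ,
      DifferentiableAt ℝ (fun z : Heis n => (N *ᵥ z.1) j) z := fun N =>
    (contDiff_mulVec N j (k := 1)).differentiable (by norm_num) z
  have hg : (fun w => gradPhi M w j) = fun z : Heis n =>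
      (4 * ((M⁻¹ *ᵥ z.1) ⬝ᵥ z.1)) * (M⁻¹ *ᵥ z.1) j +
        (4 * z.2) * (Matrix.J (Fin n) ℝ *ᵥ z.1) j := by
    funext z; simp [gradPhi]
  rw [hg, X_add ((hd.const_mul 4).fun_mul (hd' _)) ((differentiableAt_snd.const_mul 4).fun_mul (hd' _)),
    X_mul (hd.const_mul 4) (hd' _), X_mul (differentiableAt_snd.const_mul 4) (hd' _),
    X_const_mul hd, X_const_mul differentiableAt_snd, X_inv_form hN, X_snd, X_mulVec, X_mulVec]
  have := hN.apply i j
  simp [hessPhi, Matrix.vecMulVec_apply, this]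
  ring

theorem J_antisymm (i j : Fin n ⊕ Fin n) :
    Matrix.J (Fin n) ℝ j i = -Matrix.J (Fin n) ℝ i j := by
  have h := congrFun (congrFun (Matrix.J_transpose (Fin n) ℝ) i) j
  simpa using h

section Kernel

variable {δ : ℝ}

theorem alpha_pos (hδ : 0 < δ) : 0 < alpha n δ := by
  unfold alpha Q
  have : (0 : ℝ) ≤ n := Nat.cast_nonneg n
  linarith

theorem X_rpow_phiM (hN : (M⁻¹).IsSymm) (p : ℝ) {z : Heis n} (hz : 0 < phiM M z)
    (i : Fin n ⊕ Fin n) :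
    X i (fun w => phiM M w ^ p) z = p * phiM M z ^ (p - 1) * gradPhi M z i := by
  rw [X_comp (Real.hasDerivAt_rpow_const (Or.inl hz.ne'))
    ((contDiff_phiM (k := 1)).differentiable (by norm_num) z), X_phiM hN]

theorem differentiableAt_rpow_phiM (p : ℝ) {z : Heis n} (hz : 0 < phiM M z) :
    DifferentiableAt ℝ (fun w => phiM M w ^ p) z :=
  ((contDiff_phiM (k := 1)).differentiable (by norm_num) z).rpow_const (Or.inl hz.ne')

theorem X_kernel (hN : (M⁻¹).IsSymm) (hδ : 0 < δ) {z : Heis n} (hz : 0 < phiM M z)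
    (i : Fin n ⊕ Fin n) :
    X i (kernel δ M) z = phiM M z ^ (-alpha n δ - 1) * gradPhi M z i := by
  have hα := (alpha_pos (n := n) hδ).ne'
  have : kernel δ M = fun w => -(1 / alpha n δ) * phiM M w ^ (-alpha n δ) := rfl
  rw [this, X_const_mul (differentiableAt_rpow_phiM _ hz), X_rpow_phiM hN _ hz]
  field_simp

theorem X_X_kernel (hN : (M⁻¹).IsSymm) (hδ : 0 < δ) {z : Heis n} (hz : 0 < phiM M z)
    (i j : Fin n ⊕ Fin n) :
    X i (X j (kernel δ M)) z = phiM M z ^ (-alpha n δ - 1) *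
        (hessPhi M z i j + 4 * z.2 * Matrix.J (Fin n) ℝ j i) -
      (alpha n δ + 1) * phiM M z ^ (-alpha n δ - 1 - 1) * (gradPhi M z i * gradPhi M z j) := by
  have hev : X j (kernel δ M) =ᶠ[nhds z]
      fun w => phiM M w ^ (-alpha n δ - 1) * gradPhi M w j := by
    have hc : Continuous (phiM M) := (contDiff_phiM (k := 0)).continuous
    filter_upwards [hc.continuousAt.eventually (lt_mem_nhds hz)] with w hw
    exact X_kernel hN hδ hw j
  rw [X_congr hev, X_mul (differentiableAt_rpow_phiM _ hz)
    ((contDiff_gradPhi j (k := 1)).differentiable (by norm_num) z), X_rpow_phiM hN _ hz,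
    X_gradPhi hN]
  ring

theorem horizontalHessian_kernel (hN : (M⁻¹).IsSymm) (hδ : 0 < δ) {z : Heis n}
    (hz : 0 < phiM M z) :
    horizontalHessian (kernel δ M) z = phiM M z ^ (-alpha n δ - 1 - 1) •
      (phiM M z • hessPhi M z -
        (alpha n δ + 1) • Matrix.vecMulVec (gradPhi M z) (gradPhi M z)) := by
  have hp : phiM M z ^ (-alpha n δ - 1) = phiM M z ^ (-alpha n δ - 1 - 1) * phiM M z := by
    rw [Real.rpow_sub_one hz.ne' (-alpha n δ - 1)]
    field_simp
  ext i j
  have hs : hessPhi M z j i = hessPhi M z i j := by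
    simp [hessPhi, Matrix.vecMulVec_apply, hN.apply i j]
    ring
  simp only [horizontalHessian, Matrix.of_apply, X_X_kernel hN hδ hz, hp, hs, J_antisymm i j,
    Matrix.smul_apply, Matrix.sub_apply, Matrix.vecMulVec_apply, smul_eq_mul]
  ring

theorem trace_mul_hessPhi (A : Matrix (Fin n ⊕ Fin n) (Fin n ⊕ Fin n) ℝ) (z : Heis n) :
    (A * hessPhi M z).trace =
      8 * ((M⁻¹ *ᵥ z.1) ⬝ᵥ (A *ᵥ (M⁻¹ *ᵥ z.1))) +
        4 * ((M⁻¹ *ᵥ z.1) ⬝ᵥ z.1) * (A * M⁻¹).trace +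
        8 * ((Matrix.J (Fin n) ℝ *ᵥ z.1) ⬝ᵥ (A *ᵥ (Matrix.J (Fin n) ℝ *ᵥ z.1))) := by
  simp only [hessPhi, mul_add, Matrix.mul_smul, Matrix.mul_vecMulVec, Matrix.trace_add,
    Matrix.trace_smul, Matrix.trace_vecMulVec, smul_eq_mul]
  rw [dotProduct_comm (A *ᵥ _), dotProduct_comm (A *ᵥ _)]

theorem trace_mul_horizontalHessian_kernel (hN : (M⁻¹).IsSymm) (hδ : 0 < δ) {z : Heis n}
    (hz : 0 < phiM M z) (A : Matrix (Fin n ⊕ Fin n) (Fin n ⊕ Fin n) ℝ) :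
    (A * horizontalHessian (kernel δ M) z).trace = phiM M z ^ (-alpha n δ - 1 - 1) *
      (phiM M z * (A * hessPhi M z).trace -
        (alpha n δ + 1) * (gradPhi M z ⬝ᵥ (A *ᵥ gradPhi M z))) := by
  rw [horizontalHessian_kernel hN hδ hz]
  simp only [mul_sub, Matrix.mul_smul, Matrix.mul_vecMulVec, Matrix.trace_sub,
    Matrix.trace_smul, Matrix.trace_vecMulVec, smul_eq_mul]
  rw [dotProduct_comm (A *ᵥ _)]

end Kernel

/-! ### The sign of tr(A D²g_M) and the existence of admissible radii. -/

namespace IsEllipticMatrix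

theorem form_inv_mulVec (hM : IsEllipticMatrix lam Lam M) (x : Fin n ⊕ Fin n → ℝ) :
    (M⁻¹ *ᵥ x) ⬝ᵥ (M *ᵥ (M⁻¹ *ᵥ x)) = (M⁻¹ *ᵥ x) ⬝ᵥ x := by
  rw [hM.mulVec_inv_mulVec]

/-- The cross terms vanish because M(M⁻¹x) = x is orthogonal to Jx, and symplecticity turns ⟨MJx,Jx⟩
into ⟨M⁻¹x,x⟩. -/
theorem form_gradPhi (hM : IsEllipticMatrix lam Lam M) (hS : IsSymplecticMatrix M)
    (z : Heis n) :
    gradPhi M z ⬝ᵥ (M *ᵥ gradPhi M z) = 16 * ((M⁻¹ *ᵥ z.1) ⬝ᵥ z.1) * phiM M z := by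
  have h0 : (Matrix.J (Fin n) ℝ *ᵥ z.1) ⬝ᵥ z.1 = 0 := by
    rw [dotProduct_comm, dotProduct_J_mulVec_self]
  have h1 : (M⁻¹ *ᵥ z.1) ⬝ᵥ (M *ᵥ (Matrix.J (Fin n) ℝ *ᵥ z.1)) = 0 := by
    rw [dotProduct_mulVec_comm hM.isSymm, hM.mulVec_inv_mulVec, h0]
  simp only [gradPhi, Matrix.mulVec_add, Matrix.mulVec_smul, add_dotProduct, dotProduct_add,
    smul_dotProduct, dotProduct_smul, hM.mulVec_inv_mulVec, h0, h1, ← inv_form_eq hS,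
    smul_eq_mul, phiM]
  ring

theorem trace_hessPhi (hM : IsEllipticMatrix lam Lam M) (hS : IsSymplecticMatrix M)
    (z : Heis n) :
    (M * hessPhi M z).trace = 4 * ((M⁻¹ *ᵥ z.1) ⬝ᵥ z.1) * (Q n + 2) := by
  rw [trace_mul_hessPhi, hM.form_inv_mulVec, ← inv_form_eq hS, hM.mul_inv]
  simp [Q]
  ring

/-- With M = BᵀB, symplecticity gives M⁻¹ = (BJ)ᵀ(BJ), so the trace is that of the positive
semidefinite matrix (BJ)S(BJ)ᵀ. -/
theorem trace_mul_inv_nonneg (hM : IsEllipticMatrix lam Lam M) (hlam : 0 < lam)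
    (hS : IsSymplecticMatrix M) {S : Matrix (Fin n ⊕ Fin n) (Fin n ⊕ Fin n) ℝ} (hSs : S.IsSymm)
    (hSp : ∀ v, 0 ≤ v ⬝ᵥ (S *ᵥ v)) : 0 ≤ (S * M⁻¹).trace := by
  obtain ⟨B, hB⟩ := hM.exists_factor hlam
  have hpos : S.PosSemidef := .of_dotProduct_mulVec_nonneg
    (by rw [Matrix.IsHermitian, Matrix.conjTranspose_eq_transpose_of_trivial, hSs.eq])
    fun v => by simpa using hSp v
  have h := (hpos.mul_mul_conjTranspose_same (B * Matrix.J (Fin n) ℝ)).trace_nonneg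
  have h2 : M⁻¹ = (B * Matrix.J (Fin n) ℝ)ᵀ * (B * Matrix.J (Fin n) ℝ) := by
    rw [hS, hB, Matrix.transpose_mul]
    simp only [Matrix.mul_assoc]
  rw [h2, ← Matrix.mul_assoc, Matrix.trace_mul_comm, ← Matrix.mul_assoc]
  simpa using h

/-- The sign of `tr(A D² g_M)` for `A` close to `M`. -/
theorem trace_mul_hessian_kernel_nonpos {δ κ : ℝ} (hM : IsEllipticMatrix lam Lam M)
    (hlam : 0 < lam) (hS : IsSymplecticMatrix M) (hδ : 0 < δ)
    {A : Matrix (Fin n ⊕ Fin n) (Fin n ⊕ Fin n) ℝ} (hA : A.IsSymm)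
    (hκ : κ * (4 * alpha n δ + 6 + Q n) ≤ 4 * δ)
    (hlow : ∀ v, (1 - κ) * (v ⬝ᵥ (M *ᵥ v)) ≤ v ⬝ᵥ (A *ᵥ v))
    (hupp : ∀ v, v ⬝ᵥ (A *ᵥ v) ≤ (1 + κ) * (v ⬝ᵥ (M *ᵥ v))) {z : Heis n} (hz : z ≠ 0) :
    (A * horizontalHessian (kernel δ M) z).trace ≤ 0 := by
  have hφ := phiM_pos hM hlam hS hz
  have hα := alpha_pos (n := n) hδ
  have hq := hM.inv_form_nonneg hlam hS z.1
  rw [trace_mul_horizontalHessian_kernel hM.inv_isSymm hδ hφ]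
  refine mul_nonpos_of_nonneg_of_nonpos (Real.rpow_nonneg hφ.le _) ?_
  have h1 := hlow (gradPhi M z)
  rw [hM.form_gradPhi hS] at h1
  have h2 : (A * M⁻¹).trace ≤ (1 + κ) * (M * M⁻¹).trace := by
    have := hM.trace_mul_inv_nonneg hlam hS (S := (1 + κ) • M - A) ((hM.isSymm.smul _).sub hA)
      fun v => by
        rw [Matrix.sub_mulVec, Matrix.smul_mulVec, dotProduct_sub, dotProduct_smul, smul_eq_mul]
        linarith [hupp v]
    rw [Matrix.sub_mul, Matrix.smul_mul, Matrix.trace_sub, Matrix.trace_smul, smul_eq_mul] at this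
    linarith
  have h3 : (A * hessPhi M z).trace ≤ (1 + κ) * (M * hessPhi M z).trace := by
    rw [trace_mul_hessPhi, trace_mul_hessPhi]
    have := mul_le_mul_of_nonneg_left h2 hq
    linarith [hupp (M⁻¹ *ᵥ z.1), hupp (Matrix.J (Fin n) ℝ *ᵥ z.1)]
  rw [hM.trace_hessPhi hS] at h3
  have h4 := mul_le_mul_of_nonneg_left h3 hφ.le
  have h5 := mul_le_mul_of_nonneg_left h1 (by linarith : 0 ≤ alpha n δ + 1)
  -- With q = ⟨M⁻¹x,x⟩, the bounds add up to 4qφ[(1+κ)(Q+2) - 4(α+1)(1-κ)]; since 4(α+1) = Q+2+4δ,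
  -- the bracket is κ(4α+6+Q) - 4δ.
  have h6 : 0 ≤ (4 * δ - κ * (4 * alpha n δ + 6 + Q n)) *
      (4 * ((M⁻¹ *ᵥ z.1) ⬝ᵥ z.1) * phiM M z) :=
    mul_nonneg (by linarith) (by positivity)
  have h7 : 4 * alpha n δ = Q n - 2 + 4 * δ := by unfold alpha; ring
  have h8 : alpha n δ = (Q n - 2 + 4 * δ) / 4 := by linarith
  rw [h8] at h5 h6 ⊢
  nlinarith

end IsEllipticMatrix

/-- An operator norm error `om ε` is a relative error κ = `om ε / lam` with respect to M ≥ λI, so it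
suffices that κ(4α+6+Q) ≤ 4δ, which holds for small ε. -/
theorem exists_isSubsolutionRadius {δ : ℝ} (hlam : 0 < lam) (hδ : 0 < δ) {om : ℝ → ℝ}
    (hom : IsModulus om) : ∃ ε₀ : ℝ, IsSubsolutionRadius n lam Lam δ om ε₀ := by
  set c := 4 * alpha n δ + 6 + Q n
  have hc : 0 < c := by
    have := alpha_pos (n := n) hδ
    have : 0 < Q n := by unfold Q; positivity
    positivity
  have hpos : 0 < 4 * δ / c * lam := by positivity
  obtain ⟨ε, hε, hε0, hε1⟩ := ((hom.tendsto.eventually (gt_mem_nhds hpos)).and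
    (Ioo_mem_nhdsGT (zero_lt_one' ℝ))).exists
  refine ⟨ε, hε0, fun Ω A z₀ _ hA hmod hz₀ hS z hz ζ hζ => ?_⟩
  have hM := hA.isEllipticMatrix hz₀
  have hom0 : 0 ≤ om ε := (hom.mapsTo ⟨hε0.le, hε1⟩).1
  have hnorm : ‖Matrix.toEuclideanCLM (𝕜 := ℝ) (A z - A z₀)‖ ≤ om ε := by
    have h := (le_iSup₂ (f := fun z (_ : z ∈ ball z₀ ε ∩ Ω) =>
      ‖Matrix.toEuclideanCLM (𝕜 := ℝ) (A z - A z₀)‖ₑ) z hz).trans (hmod.2 z₀ hz₀ ε hε0 hε1)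
    rwa [← ofReal_norm, ENNReal.ofReal_le_ofReal_iff hom0] at h
  have hform : ∀ v, |v ⬝ᵥ ((A z - A z₀) *ᵥ v)| ≤ om ε / lam * (v ⬝ᵥ (A z₀ *ᵥ v)) := by
    intro v
    have h1 := Matrix.inner_toEuclideanCLM (A z - A z₀) (WithLp.toLp 2 v) (WithLp.toLp 2 v)
    have h2 : ‖WithLp.toLp 2 v‖ * ‖WithLp.toLp 2 v‖ = v ⬝ᵥ v := by
      rw [← sq, EuclideanSpace.real_norm_sq_eq]
      simp [dotProduct, sq]
    have h3 := (abs_real_inner_le_norm (WithLp.toLp 2 v)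
      (Matrix.toEuclideanCLM (𝕜 := ℝ) (A z - A z₀) (WithLp.toLp 2 v)))
    rw [h1] at h3
    have h4 := (Matrix.toEuclideanCLM (𝕜 := ℝ) (A z - A z₀)).le_of_opNorm_le hnorm
      (WithLp.toLp 2 v)
    have h5 := mul_le_mul_of_nonneg_left h4 (norm_nonneg (WithLp.toLp 2 v))
    calc |v ⬝ᵥ ((A z - A z₀) *ᵥ v)| ≤ om ε * (v ⬝ᵥ v) := by
          rw [← h2]; linarith [h3.trans h5]
      _ = om ε / lam * (lam * (v ⬝ᵥ v)) := by field_simp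
      _ ≤ _ := mul_le_mul_of_nonneg_left (hM.lower v) (by positivity)
  have hκ : om ε / lam * c ≤ 4 * δ := by
    rw [div_mul_eq_mul_div, div_le_iff₀ hlam]
    have := mul_lt_mul_of_pos_right hε hc
    have h2 : 4 * δ / c * lam * c = 4 * δ * lam := by field_simp
    linarith
  have := hM.trace_mul_hessian_kernel_nonpos (κ := om ε / lam) (A := A z) hlam hS hδ
    (hA z hz.2).1 hκ
    (fun v => by
      have := (abs_le.1 (hform v)).1
      rw [Matrix.sub_mulVec, dotProduct_sub] at this
      linarith)
    (fun v => by
      have := (abs_le.1 (hform v)).2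
      rw [Matrix.sub_mulVec, dotProduct_sub] at this
      linarith) hζ
  linarith

end Heisenberg

/-! ### The radial step function and the constant it produces. -/

namespace Heisenberg

variable {n : ℕ} {lam Lam δ : ℝ} {M : Matrix (Fin n ⊕ Fin n) (Fin n ⊕ Fin n) ℝ}

/-- A smooth non-increasing function equal to `1` on `s ≤ 1` and to `0` on `s ≥ 2`. -/
noncomputable def step (s : ℝ) : ℝ := Real.smoothTransition (2 - s)

theorem contDiff_step : ContDiff ℝ ∞ step :=
  Real.smoothTransition.contDiff.comp (contDiff_const.sub contDiff_id)

theorem antitone_step : Antitone step := fun _ _ h =>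
  Real.smoothTransition.monotone (by linarith)

theorem step_nonneg (s : ℝ) : 0 ≤ step s := Real.smoothTransition.nonneg _

theorem step_eq_one {s : ℝ} (h : s ≤ 1) : step s = 1 :=
  Real.smoothTransition.one_of_one_le (by linarith)

theorem step_eq_zero {s : ℝ} (h : 2 ≤ s) : step s = 0 :=
  Real.smoothTransition.zero_of_nonpos (by linarith)

theorem deriv_step_nonpos (s : ℝ) : deriv step s ≤ 0 := antitone_step.deriv_nonpos

theorem hasDerivAt_step (s : ℝ) : HasDerivAt step (deriv step s) s :=
  ((contDiff_step.differentiable (by norm_num)) s).hasDerivAt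

theorem continuous_deriv_step : Continuous (deriv step) :=
  contDiff_step.continuous_deriv (by norm_num)

theorem deriv_step_eq_zero_of_lt {s : ℝ} (h : s < 1) : deriv step s = 0 := by
  have : step =ᶠ[nhds s] fun _ => 1 :=
    (gt_mem_nhds h).mono fun t ht => step_eq_one (le_of_lt ht)
  rw [this.deriv_eq, deriv_const]

theorem deriv_step_eq_zero_of_gt {s : ℝ} (h : 2 < s) : deriv step s = 0 := by
  have : step =ᶠ[nhds s] fun _ => 0 :=
    (lt_mem_nhds h).mono fun t ht => step_eq_zero (le_of_lt ht)
  rw [this.deriv_eq, deriv_const]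

/-- The radial weight `-step'(s) s^{-a}`. -/
noncomputable def weight (a s : ℝ) : ℝ := -deriv step s * s ^ (-a)

theorem weight_nonneg (a : ℝ) {s : ℝ} (hs : 0 ≤ s) : 0 ≤ weight a s :=
  mul_nonneg (neg_nonneg.2 (deriv_step_nonpos s)) (Real.rpow_nonneg hs _)

/-- The power may be singular at 0, but the derivative of `step` vanishes for s < 1. -/
theorem continuous_weight (a : ℝ) : Continuous (weight a) := by
  rw [continuous_iff_continuousAt]
  intro s
  rcases lt_or_ge s 1 with h | h
  · have : weight a =ᶠ[nhds s] fun _ => 0 :=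
      (gt_mem_nhds h).mono fun t ht => by simp [weight, deriv_step_eq_zero_of_lt ht]
    exact this.continuousAt
  · exact continuous_deriv_step.neg.continuousAt.mul
      (Real.continuousAt_rpow_const _ _ (Or.inl (by linarith : (0 : ℝ) < s).ne'))

theorem isCompact_phiM_le (hM : IsEllipticMatrix lam Lam M) (hlam : 0 < lam)
    (hS : IsSymplecticMatrix M) (c : ℝ) : IsCompact {z : Heis n | phiM M z ≤ c} := by
  have hcont : Continuous (phiM M) := (contDiff_phiM (k := 0)).continuous
  refine Metric.isCompact_of_isClosed_isBounded (isClosed_le hcont continuous_const) ?_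
  -- A crude radius: s² ≤ b is only used as |s| ≤ b + 1, which avoids roots.
  set D := (|c| + 1) / lam + 1 + (|c| + 1)
  have hc := abs_nonneg c
  have hDl : 0 ≤ (|c| + 1) / lam := by positivity
  refine (Metric.isBounded_closedBall (x := (0 : Heis n)) (r := D)).subset fun z hz => ?_
  have hz' : ((M⁻¹ *ᵥ z.1) ⬝ᵥ z.1) ^ 2 + z.2 ^ 2 ≤ |c| := le_trans hz (le_abs_self c)
  have hq : (M⁻¹ *ᵥ z.1) ⬝ᵥ z.1 ≤ |c| + 1 := by nlinarith [sq_nonneg z.2]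
  have ht : |z.2| ≤ |c| + 1 := by
    have h := sq_abs z.2
    nlinarith [sq_nonneg ((M⁻¹ *ᵥ z.1) ⬝ᵥ z.1), abs_nonneg z.2]
  have hx : z.1 ⬝ᵥ z.1 ≤ (|c| + 1) / lam := by
    rw [le_div_iff₀ hlam]
    linarith [hM.inv_form_lower hS z.1]
  rw [mem_closedBall_zero_iff, Prod.norm_def, max_le_iff, pi_norm_le_iff_of_nonneg (by positivity)]
  refine ⟨fun i => ?_, ?_⟩
  · have h1 : z.1 i * z.1 i ≤ z.1 ⬝ᵥ z.1 :=
      Finset.single_le_sum (f := fun i => z.1 i * z.1 i) (fun j _ => mul_self_nonneg _)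
        (Finset.mem_univ i)
    have h2 := abs_mul_abs_self (z.1 i)
    rw [Real.norm_eq_abs]
    have h3 : |z.1 i| ≤ (|c| + 1) / lam + 1 := by nlinarith [abs_nonneg (z.1 i)]
    linarith
  · rw [Real.norm_eq_abs]
    linarith

theorem isEllipticMatrix_one :
    IsEllipticMatrix 1 1 (1 : Matrix (Fin n ⊕ Fin n) (Fin n ⊕ Fin n) ℝ) :=
  ⟨Matrix.isSymm_one, Matrix.det_one, by simp, by simp⟩

theorem isSymplecticMatrix_one :
    IsSymplecticMatrix (1 : Matrix (Fin n ⊕ Fin n) (Fin n ⊕ Fin n) ℝ) := by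
  simp [IsSymplecticMatrix, Matrix.J_squared]

theorem phiM_one (z : Heis n) : phiM 1 z = (z.1 ⬝ᵥ z.1) ^ 2 + z.2 ^ 2 := by
  simp [phiM]

/-- The constant `∫ -step'(φ) φ^{-α} |x|²` for the standard gauge. -/
noncomputable def gaugeConst (n : ℕ) (a : ℝ) : ℝ :=
  ∫ w : Heis n, weight a (phiM 1 w) * (w.1 ⬝ᵥ w.1)

theorem gaugeConst_pos (hn : 1 ≤ n) (a : ℝ) : 0 < gaugeConst n a := by
  -- `step` drops from 1 to 0 on [1,2], so its derivative is -1 at some s; a horizontal point with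
  -- |x|⁴ = s then has φ = s and |x|² = √s > 0.
  obtain ⟨s, ⟨hs1, hs2⟩, hs⟩ := exists_hasDerivAt_eq_slope step (deriv step)
    (by norm_num : (1 : ℝ) < 2) contDiff_step.continuous.continuousOn
    (fun x _ => hasDerivAt_step x)
  rw [step_eq_one le_rfl, step_eq_zero le_rfl] at hs
  have hspos : 0 < s := by linarith
  have hφ : Continuous (phiM (1 : Matrix (Fin n ⊕ Fin n) (Fin n ⊕ Fin n) ℝ)) :=
    (contDiff_phiM (k := 0)).continuous
  set w : Heis n := (Pi.single (Sum.inl ⟨0, hn⟩) √√s, 0)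
  have hw1 : w.1 ⬝ᵥ w.1 = √s := by simp [w]
  have hw : phiM 1 w = s := by
    rw [phiM_one, hw1, Real.sq_sqrt hspos.le]
    simp [w]
  refine Continuous.integral_pos_of_hasCompactSupport_nonneg_nonzero (x := w) ?_ ?_ ?_ ?_
  · refine ((continuous_weight a).comp hφ).mul ?_
    simp only [dotProduct]
    fun_prop
  · refine HasCompactSupport.intro
      (isCompact_phiM_le isEllipticMatrix_one one_pos isSymplecticMatrix_one 2) fun w hw => ?_
    rw [Set.mem_ofPred_eq, not_le] at hw
    simp [weight, deriv_step_eq_zero_of_gt hw]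
  · exact fun w => mul_nonneg (weight_nonneg a (phiM_nonneg w)) (dotProduct_self_nonneg' _)
  · rw [hw, hw1, weight, hs]
    have := Real.rpow_pos_of_pos hspos (-a)
    have := Real.sqrt_pos.2 hspos
    norm_num
    exact ⟨by positivity, by positivity⟩

/-- Substitute (x,t) = (R Bᵀy, R²τ) with M = BᵀB. Then ⟨M⁻¹x,x⟩ = R²|y|², and the Jacobian is R^Q
because |det B| = 1. The powers of R add up to -4 - 4α + 2 + Q = -4δ. -/
theorem integral_weight_phiM (hM : IsEllipticMatrix lam Lam M) (hlam : 0 < lam)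
    {R : ℝ} (hR : 0 < R) :
    ∫ w : Heis n, R ^ (-4 : ℝ) * (phiM M w ^ (-alpha n δ) * -deriv step (phiM M w / R ^ 4)) *
        ((M⁻¹ *ᵥ w.1) ⬝ᵥ w.1) = R ^ (-4 * δ) * gaugeConst n (alpha n δ) := by
  obtain ⟨B, hB⟩ := hM.exists_factor hlam
  have hdet : B.det * B.det = 1 := by
    rw [← hM.det_eq, hB, Matrix.det_mul, Matrix.det_transpose]
  have habs : |B.det| = 1 := by
    have h := abs_mul_abs_self B.det
    rw [hdet] at h
    nlinarith [abs_nonneg B.det]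
  have hu : IsUnit B.det := IsUnit.of_mul_eq_one _ hdet
  have hinv : B * (M⁻¹ * Bᵀ) = 1 := by
    rw [hB, Matrix.mul_inv_rev, Matrix.mul_assoc, Matrix.nonsing_inv_mul Bᵀ (by simpa using hu),
      Matrix.mul_one, Matrix.mul_nonsing_inv _ hu]
  have hq : ∀ y : Fin n ⊕ Fin n → ℝ, (M⁻¹ *ᵥ (Bᵀ *ᵥ y)) ⬝ᵥ (Bᵀ *ᵥ y) = y ⬝ᵥ y := by
    intro y
    rw [Matrix.dotProduct_mulVec, Matrix.vecMul_transpose, Matrix.mulVec_mulVec,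
      Matrix.mulVec_mulVec, Matrix.mul_assoc, hinv, Matrix.one_mulVec]
  have hdetR : (R • Bᵀ).det ≠ 0 := by
    rw [Matrix.det_smul, Matrix.det_transpose]
    exact mul_ne_zero (pow_ne_zero _ hR.ne') hu.ne_zero
  set T : Heis n → Heis n := Prod.map (Matrix.toLin' (R • Bᵀ)) (R ^ 2 * ·)
  have hTm1 : Measurable (Matrix.toLin' (R • Bᵀ)) :=
    (LinearMap.continuous_of_finiteDimensional _).measurable
  have hTm : Measurable T := hTm1.prodMap (measurable_const_mul _)
  have hTφ : ∀ w, phiM M (T w) = R ^ 4 * phiM 1 w := by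
    intro w
    rw [phiM_one]
    simp only [phiM, T, Prod.map_fst, Prod.map_snd, Matrix.toLin'_apply, Matrix.smul_mulVec,
      Matrix.mulVec_smul, smul_dotProduct, dotProduct_smul, hq, smul_eq_mul]
    ring
  have hTq : ∀ w : Heis n, (M⁻¹ *ᵥ (T w).1) ⬝ᵥ (T w).1 = R ^ 2 * (w.1 ⬝ᵥ w.1) := by
    intro w
    simp only [T, Prod.map_fst, Matrix.toLin'_apply, Matrix.smul_mulVec,
      Matrix.mulVec_smul, smul_dotProduct, dotProduct_smul, hq, smul_eq_mul]
    ring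
  have hmap : Measure.map T volume = ENNReal.ofReal (R ^ (-Q n)) • volume := by
    have h1 := Real.map_matrix_volume_pi_eq_smul_volume_pi hdetR
    have h2 := Real.map_volume_mul_left (pow_ne_zero 2 hR.ne')
    have h3 : Measure.map T (volume : Measure (Heis n)) =
        (Measure.map (Matrix.toLin' (R • Bᵀ)) volume).prod (Measure.map (R ^ 2 * ·) volume) :=
      (Measure.map_prod_map _ _ hTm1 (measurable_const_mul _)).symm
    rw [h3, h1, h2, Measure.prod_smul_left, Measure.prod_smul_right, smul_smul,
      ← ENNReal.ofReal_mul (abs_nonneg _)]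
    congr 2
    rw [Matrix.det_smul, Matrix.det_transpose, abs_inv, abs_inv, abs_mul, habs, mul_one,
      abs_of_pos (pow_pos hR _), abs_of_pos (pow_pos hR _), ← mul_inv, ← pow_add,
      Real.rpow_neg hR.le, ← Real.rpow_natCast]
    congr 2
    simp [Q]
    ring
  set F : Heis n → ℝ := fun w => R ^ (-4 : ℝ) *
    (phiM M w ^ (-alpha n δ) * -deriv step (phiM M w / R ^ 4)) * ((M⁻¹ *ᵥ w.1) ⬝ᵥ w.1)
  have hFm : Measurable F := by
    have hφ : Measurable (phiM M) := (contDiff_phiM (k := 0)).continuous.measurable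
    have hq' : Measurable fun z : Heis n => (M⁻¹ *ᵥ z.1) ⬝ᵥ z.1 :=
      (contDiff_inv_form (k := 0)).continuous.measurable
    exact (((hφ.pow_const _).mul
      (continuous_deriv_step.measurable.comp (hφ.div_const _)).neg).const_mul _).mul hq'
  have h := integral_map (μ := volume) hTm.aemeasurable
    (hFm.aestronglyMeasurable (μ := Measure.map T volume))
  rw [hmap, integral_smul_measure, ENNReal.toReal_ofReal (Real.rpow_nonneg hR.le _)] at h
  have hFT : ∀ w, F (T w) = R ^ (-4 * δ - Q n) * (weight (alpha n δ) (phiM 1 w) *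
      (w.1 ⬝ᵥ w.1)) := by
    intro w
    have hR4 : R ^ 4 * phiM 1 w / R ^ 4 = phiM 1 w := by field_simp
    have hpow : R ^ (-4 * δ - Q n) = R ^ (-4 : ℝ) * (R ^ 4) ^ (-alpha n δ) * R ^ 2 := by
      rw [← Real.rpow_natCast R 4, ← Real.rpow_natCast R 2, ← Real.rpow_mul hR.le,
        ← Real.rpow_add hR, ← Real.rpow_add hR]
      congr 1
      unfold alpha
      push_cast
      ring
    simp only [F, hTφ, hTq, hR4, weight]
    rw [Real.mul_rpow (by positivity) (phiM_nonneg w), hpow]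
    ring
  simp only [hFT] at h
  rw [integral_const_mul] at h
  have hRQ : R ^ (-4 * δ - Q n) = R ^ (-4 * δ) * R ^ (-Q n) := by
    rw [← Real.rpow_add hR]; ring_nf
  rw [hRQ, smul_eq_mul] at h
  have hpos := Real.rpow_pos_of_pos hR (-Q n)
  refine mul_left_cancel₀ hpos.ne' ?_
  rw [h, gaugeConst]
  ring

end Heisenberg

/-! ### The cut off kernel, its potential, and integration by parts. -/

namespace Heisenberg

variable {n : ℕ} {lam Lam δ μ : ℝ} {M : Matrix (Fin n ⊕ Fin n) (Fin n ⊕ Fin n) ℝ} {ψ : ℝ → ℝ}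

/-- The kernel `g_M`, cut off near the origin at scale `μ`. -/
noncomputable def cutKernel (δ : ℝ) (M : Matrix (Fin n ⊕ Fin n) (Fin n ⊕ Fin n) ℝ) (ψ : ℝ → ℝ)
    (μ : ℝ) (w : Heis n) : ℝ :=
  ψ (rhoM M w / μ) * kernel δ M w

theorem one_add_one_le_infty : (1 + 1 : WithTop ℕ∞) ≤ ∞ := by
  rw [one_add_one_eq_two]
  exact WithTop.coe_le_coe.2 (le_top : (2 : ℕ∞) ≤ ⊤)

theorem continuous_phiM : Continuous (phiM M) := (contDiff_phiM (k := 0)).continuous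

theorem continuous_rhoM : Continuous (rhoM M) :=
  continuous_phiM.rpow_const fun _ => Or.inr (by norm_num)

theorem rhoM_pow_four (w : Heis n) : rhoM M w ^ 4 = phiM M w := by
  rw [rhoM, ← Real.rpow_natCast, ← Real.rpow_mul (phiM_nonneg w)]
  norm_num

theorem rhoM_nonneg (w : Heis n) : 0 ≤ rhoM M w := Real.rpow_nonneg (phiM_nonneg w) _

theorem rho_eq_rhoM (w : Heis n) : rho w = rhoM 1 w := by
  rw [rho, rhoM, phiM_one]

/-- The product vanishes where ρ_M < μ, a neighbourhood of the origin; elsewhere φ_M > 0 and its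
real powers are smooth. -/
theorem contDiff_cutKernel (hM : IsEllipticMatrix lam Lam M) (hlam : 0 < lam)
    (hS : IsSymplecticMatrix M) (hψ : IsCutoff ψ) (hμ : 0 < μ) :
    ContDiff ℝ ∞ (cutKernel δ M ψ μ) := by
  rw [contDiff_iff_contDiffAt]
  intro w
  rcases eq_or_ne w 0 with rfl | hw
  · have h0 : rhoM M (0 : Heis n) < μ := by
      rw [rhoM, phiM_zero, Real.zero_rpow (by norm_num)]
      exact hμ
    have : cutKernel δ M ψ μ =ᶠ[nhds 0] fun _ => 0 := by
      filter_upwards [continuous_rhoM.continuousAt.eventually (gt_mem_nhds h0)] with v hv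
      rw [cutKernel, hψ.eq_zero _ ((div_lt_one hμ).2 hv), zero_mul]
    exact contDiffAt_const.congr_of_eventuallyEq this
  · have hφ := (phiM_pos hM hlam hS hw).ne'
    have hp : ∀ p : ℝ, ContDiffAt ℝ ∞ (fun v => phiM M v ^ p) w := fun p =>
      contDiff_phiM.contDiffAt.rpow_const_of_ne hφ
    exact (hψ.smooth.contDiffAt.comp w ((hp _).div_const μ)).mul (contDiffAt_const.mul (hp _))

theorem cutKernel_eventuallyEq (hψ : IsCutoff ψ) (hμ : 0 < μ) {w : Heis n}
    (hw : 2 * μ < rhoM M w) : cutKernel δ M ψ μ =ᶠ[nhds w] kernel δ M := by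
  filter_upwards [continuous_rhoM.continuousAt.eventually (lt_mem_nhds hw)] with v hv
  rw [cutKernel, hψ.eq_one _ ((le_div_iff₀ hμ).2 hv.le), one_mul]

/-- Group inversion is negation. Since φ_M is even, the cutoff and the kernel can be evaluated at
the same argument ζ⁻¹∘z. -/
theorem comp_inv_swap (z ζ : Heis n) : comp (inv z) ζ = -comp (inv ζ) z := by
  have h : (Matrix.J (Fin n) ℝ *ᵥ z.1) ⬝ᵥ ζ.1 = -((Matrix.J (Fin n) ℝ *ᵥ ζ.1) ⬝ᵥ z.1) := by
    rw [dotProduct_comm, Matrix.dotProduct_mulVec,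
      ← Matrix.mulVec_transpose, Matrix.J_transpose, Matrix.neg_mulVec, neg_dotProduct]
  rw [comp_inv_eq, comp_inv_eq, h]
  ext k
  · simp
  · simp; ring

theorem hmu_eq (O : Set (Heis n)) (z : Heis n) :
    hmu δ M ψ O μ z = ∫ ζ in O, cutKernel δ M ψ μ (comp (inv ζ) z) := by
  simp only [hmu, cutKernel, distM, kernel]
  congr 1
  funext ζ
  rw [comp_inv_swap z ζ, phiM_neg]

theorem continuous_comp : Continuous fun p : Heis n × Heis n => comp p.1 p.2 := by
  simp only [comp, Matrix.mulVec, dotProduct]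
  fun_prop

theorem comp_inv_cancel (z ζ : Heis n) : comp z (comp (inv z) ζ) = ζ := by
  rw [comp_inv_eq]
  ext k
  · simp [comp]
  · have h : (Matrix.J (Fin n) ℝ *ᵥ z.1) ⬝ᵥ z.1 = 0 := by
      rw [dotProduct_comm, dotProduct_J_mulVec_self]
    simp only [comp, dotProduct_sub, h]
    ring

theorem phiM_one_lt_of_mem_ball {z ζ : Heis n} {r : ℝ} (h : ζ ∈ ball z r) :
    phiM 1 (comp (inv z) ζ) < r ^ 4 := by
  have h' : rhoM 1 (comp (inv z) ζ) < r := by rw [← rho_eq_rhoM]; exact h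
  rw [← rhoM_pow_four]
  exact pow_lt_pow_left₀ h' (rhoM_nonneg _) (by norm_num)

theorem isCompact_closure_of_subset_ball {O : Set (Heis n)} {z : Heis n} {r : ℝ}
    (h : O ⊆ ball z r) : IsCompact (closure O) := by
  have hK := (isCompact_phiM_le (n := n) isEllipticMatrix_one one_pos isSymplecticMatrix_one
    (r ^ 4)).image (continuous_comp.comp (Continuous.prodMk_right z))
  refine hK.of_isClosed_subset isClosed_closure (closure_minimal (fun ζ hζ => ?_) hK.isClosed)
  exact ⟨comp (inv z) ζ, (phiM_one_lt_of_mem_ball (h hζ)).le, comp_inv_cancel z ζ⟩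

theorem trace_mul_horizontalHessian {A : Matrix (Fin n ⊕ Fin n) (Fin n ⊕ Fin n) ℝ}
    (hA : A.IsSymm) (u : Heis n → ℝ) (z : Heis n) :
    (A * horizontalHessian u z).trace = ∑ i, ∑ j, A i j * X i (X j u) z := by
  have h1 : (A * horizontalHessian u z).trace =
      ∑ i, ∑ j, (A i j * X j (X i u) z / 2 + A i j * X i (X j u) z / 2) := by
    simp only [Matrix.trace, Matrix.diag, Matrix.mul_apply, horizontalHessian, Matrix.of_apply]
    refine Finset.sum_congr rfl fun i _ => Finset.sum_congr rfl fun j _ => by ring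
  have h2 : ∑ i, ∑ j, A i j * X j (X i u) z / 2 = ∑ i, ∑ j, A i j * X i (X j u) z / 2 := by
    rw [Finset.sum_comm]
    refine Finset.sum_congr rfl fun i _ => Finset.sum_congr rfl fun j _ => by rw [hA.apply]
  simp only [h1, Finset.sum_add_distrib, h2]
  rw [← Finset.sum_add_distrib]
  refine Finset.sum_congr rfl fun i _ => ?_
  rw [← Finset.sum_add_distrib]
  refine Finset.sum_congr rfl fun j _ => by ring

theorem continuous_trace_hessian {A : Matrix (Fin n ⊕ Fin n) (Fin n ⊕ Fin n) ℝ}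
    (hA : A.IsSymm) {k : Heis n → ℝ} (hk : ContDiff ℝ ∞ k) :
    Continuous fun w => (A * horizontalHessian k w).trace := by
  simp only [trace_mul_horizontalHessian hA]
  refine continuous_finsetSum _ fun i _ => continuous_finsetSum _ fun j _ =>
    continuous_const.mul ?_
  exact (contDiff_X (m := 0) (contDiff_X (m := 1) hk one_add_one_le_infty j)
    (by simp) i).continuous

theorem continuous_comp_inv (z : Heis n) : Continuous fun ζ : Heis n => comp (inv ζ) z :=
  (contDiff_comp_inv (k := 0)).continuous.comp (Continuous.prodMk_right z)

/-- Differentiation of the potential of a smooth kernel under the integral sign. -/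
theorem trace_hessian_integral {A : Matrix (Fin n ⊕ Fin n) (Fin n ⊕ Fin n) ℝ}
    (hA : A.IsSymm) {ν : Measure (Heis n)} [IsLocallyFiniteMeasure ν] {C : Set (Heis n)}
    (hC : IsCompact C) {k : Heis n → ℝ} (hk : ContDiff ℝ ∞ k) (z : Heis n) :
    (A * horizontalHessian (fun z => ∫ ζ in C, k (comp (inv ζ) z) ∂ν) z).trace =
      ∫ ζ in C, (A * horizontalHessian k (comp (inv ζ) z)).trace ∂ν := by
  have hk1 : ContDiff ℝ 1 k := hk.of_le (by exact mod_cast le_top)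
  have hX : ∀ j, ContDiff ℝ 1 (X j k) := contDiff_X hk one_add_one_le_infty
  have hXX : ∀ i j, Continuous (X i (X j k)) := fun i j =>
    (contDiff_X (m := 0) (hX j) (by simp) i).continuous
  have hint : ∀ i j, Integrable (fun ζ => A i j * X i (X j k) (comp (inv ζ) z))
      (ν.restrict C) := fun i j =>
    ContinuousOn.integrableOn_compact hC
      (continuous_const.mul ((hXX i j).comp (continuous_comp_inv z))).continuousOn
  have h1 : ∀ j, X j (fun z => ∫ ζ in C, k (comp (inv ζ) z) ∂ν) =
      fun z => ∫ ζ in C, X j k (comp (inv ζ) z) ∂ν := fun j => by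
    funext w; exact X_integral hC hk1 j w
  simp only [trace_mul_horizontalHessian hA, h1, X_integral hC (hX _)]
  rw [integral_finsetSum _ fun i _ => integrable_finsetSum _ fun j _ => hint i j]
  refine Finset.sum_congr rfl fun i _ => ?_
  rw [integral_finsetSum _ fun j _ => hint i j]
  refine Finset.sum_congr rfl fun j _ => (integral_const_mul _ _).symm

/-- Integration by parts for the second order operator with constant coefficients. -/
theorem integral_mul_trace_hessian {A : Matrix (Fin n ⊕ Fin n) (Fin n ⊕ Fin n) ℝ}
    (hA : A.IsSymm) {χ k : Heis n → ℝ} (hχ : ContDiff ℝ ∞ χ) (hc : HasCompactSupport χ)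
    (hk : ContDiff ℝ ∞ k) :
    Integrable (fun w => -∑ i, ∑ j, A i j * (X i χ w * X j k w)) ∧
    ∫ w, χ w * (A * horizontalHessian k w).trace =
      ∫ w, -∑ i, ∑ j, A i j * (X i χ w * X j k w) := by
  have hχ1 : ContDiff ℝ 1 χ := hχ.of_le (by exact mod_cast le_top)
  have hX : ∀ j, ContDiff ℝ 1 (X j k) := contDiff_X hk one_add_one_le_infty
  have hXX : ∀ i j, Continuous (X i (X j k)) := fun i j =>
    (contDiff_X (m := 0) (hX j) (by simp) i).continuous
  have hXχ : ∀ i, Continuous (X i χ) := fun i =>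
    (contDiff_X (m := 0) hχ1 (by simp) i).continuous
  have hcX : ∀ i, HasCompactSupport (X i χ) := fun i =>
    (hc.fderiv ℝ).mono fun w hw h0 => hw (by rw [X_eq, h0]; rfl)
  have hi1 : ∀ i j, Integrable (fun w => χ w * X i (X j k) w) := fun i j =>
    (hχ.continuous.mul (hXX i j)).integrable_of_hasCompactSupport hc.mul_right
  have hi2 : ∀ i j, Integrable (fun w => X i χ w * X j k w) := fun i j =>
    ((hXχ i).mul (hX j).continuous).integrable_of_hasCompactSupport (hcX i).mul_right
  have hparts : ∀ i j, ∫ w, χ w * X i (X j k) w = -∫ w, X i χ w * X j k w := by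
    intro i j
    -- Integrate the derivative X_i(χ X_j k) of a compactly supported function.
    have h0 := integral_X_eq_zero (hχ1.mul (hX j)) hc.mul_right i
    have h1 : ∀ w, X i (fun w => χ w * X j k w) w = χ w * X i (X j k) w + X i χ w * X j k w :=
      fun w => by
        rw [X_mul (hχ1.differentiable (by norm_num) w) ((hX j).differentiable (by norm_num) w)]
        ring
    simp only [h1] at h0
    rw [integral_add (hi1 i j) (hi2 i j)] at h0
    linarith
  have hi3 : ∀ i j, Integrable (fun w => A i j * (X i χ w * X j k w)) := fun i j =>
    (hi2 i j).const_mul _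
  have hi4 : ∀ i j, Integrable (fun w => χ w * (A i j * X i (X j k) w)) := fun i j =>
    ((hi1 i j).const_mul (A i j)).congr (Filter.Eventually.of_forall fun w => by simp only; ring)
  refine ⟨(integrable_finsetSum _ fun i _ => integrable_finsetSum _ fun j _ => hi3 i j).neg, ?_⟩
  simp only [trace_mul_horizontalHessian hA, Finset.mul_sum]
  rw [integral_neg, integral_finsetSum _ fun i _ => integrable_finsetSum _ fun j _ => hi4 i j,
    integral_finsetSum _ fun i _ => integrable_finsetSum _ fun j _ => hi3 i j,
    ← Finset.sum_neg_distrib]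
  refine Finset.sum_congr rfl fun i _ => ?_
  rw [integral_finsetSum _ fun j _ => hi4 i j, integral_finsetSum _ fun j _ => hi3 i j,
    ← Finset.sum_neg_distrib]
  refine Finset.sum_congr rfl fun j _ => ?_
  rw [integral_const_mul, ← mul_neg, ← hparts, ← integral_const_mul]
  congr 1
  funext w
  ring

theorem sum_mul_mul_eq (A : Matrix (Fin n ⊕ Fin n) (Fin n ⊕ Fin n) ℝ)
    (v : Fin n ⊕ Fin n → ℝ) (c : ℝ) :
    ∑ i, ∑ j, A i j * (c * (v i * v j)) = c * (v ⬝ᵥ (A *ᵥ v)) := by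
  simp only [dotProduct, Matrix.mulVec, Finset.mul_sum]
  refine Finset.sum_congr rfl fun i _ => Finset.sum_congr rfl fun j _ => by ring

/-- Lower bound for the cut off integral of `tr(A D² g)`, from integration by parts. -/
theorem integral_step_mul_trace_hessian_ge (hM : IsEllipticMatrix lam Lam M) (hlam : 0 < lam)
    (hLam : lam ≤ Lam) (hS : IsSymplecticMatrix M) (hδ : 0 < δ)
    {A : Matrix (Fin n ⊕ Fin n) (Fin n ⊕ Fin n) ℝ} (hA : IsEllipticMatrix lam Lam A)
    (hψ : IsCutoff ψ) (hμ : 0 < μ) {R : ℝ} (hR : 2 * μ < R) :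
    16 * (lam / Lam) * (R ^ (-4 * δ) * gaugeConst n (alpha n δ)) ≤
      ∫ w : Heis n, step (phiM M w / R ^ 4) *
        (A * horizontalHessian (cutKernel δ M ψ μ) w).trace := by
  have hR0 : 0 < R := by linarith
  have hR4 : 0 < R ^ 4 := by positivity
  have hL0 : 0 < Lam := hlam.trans_le hLam
  set χ : Heis n → ℝ := fun w => step (phiM M w / R ^ 4)
  have hχ : ContDiff ℝ ∞ χ := contDiff_step.comp (contDiff_phiM.div_const _)
  have hc : HasCompactSupport χ := HasCompactSupport.intro
    (isCompact_phiM_le hM hlam hS (2 * R ^ 4)) fun w hw => by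
      rw [Set.mem_ofPred_eq, not_le] at hw
      exact step_eq_zero ((le_div_iff₀ hR4).2 hw.le)
  obtain ⟨hint, heq⟩ := integral_mul_trace_hessian (k := cutKernel δ M ψ μ) hA.isSymm hχ hc
    (contDiff_cutKernel hM hlam hS hψ hμ)
  rw [heq, ← integral_weight_phiM hM hlam hR0, ← integral_const_mul]
  have hXχ : ∀ i w, X i χ w = R ^ (-4 : ℝ) * deriv step (phiM M w / R ^ 4) * gradPhi M w i := by
    intro i w
    have h1 : HasDerivAt (fun s => step (s / R ^ 4))
        (deriv step (phiM M w / R ^ 4) * (1 / R ^ 4)) (phiM M w) :=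
      (hasDerivAt_step _).comp (phiM M w) ((hasDerivAt_id' _).div_const _)
    have h2 := X_comp h1 ((contDiff_phiM (k := 1)).differentiable (by norm_num) w) i
    rw [X_phiM hM.inv_isSymm] at h2
    have h3 : R ^ (-4 : ℝ) = 1 / R ^ 4 := by
      rw [Real.rpow_neg hR0.le, one_div]
      congr 1
      exact_mod_cast Real.rpow_natCast R 4
    rw [h3, mul_comm (1 / R ^ 4)]
    exact h2
  refine integral_mono_of_nonneg (Filter.Eventually.of_forall fun w => ?_) hint
    (Filter.Eventually.of_forall fun w => ?_)
  · have h1 := hM.inv_form_nonneg hlam hS w.1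
    have h2 := neg_nonneg.2 (deriv_step_nonpos (phiM M w / R ^ 4))
    have h3 := Real.rpow_nonneg (phiM_nonneg (M := M) w) (-alpha n δ)
    simp only [Pi.zero_apply]
    positivity
  · simp only [hXχ]
    -- Where φ_M < R⁴ the derivative of `step` is zero; elsewhere ρ_M ≥ R > 2μ, so the cutoff is
    -- inactive.
    rcases lt_or_ge (phiM M w / R ^ 4) 1 with h | h
    · simp [deriv_step_eq_zero_of_lt h]
    have hφR : R ^ 4 ≤ phiM M w := by rwa [le_div_iff₀ hR4, one_mul] at h
    have hφ : 0 < phiM M w := hR4.trans_le hφR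
    have hρ : 2 * μ < rhoM M w := by
      refine hR.trans_le (le_of_pow_le_pow_left₀ (n := 4) (by norm_num) (rhoM_nonneg w) ?_)
      rwa [rhoM_pow_four]
    have hk : ∀ j, X j (cutKernel δ M ψ μ) w =
        phiM M w ^ (-alpha n δ - 1) * gradPhi M w j := fun j => by
      rw [X_congr (cutKernel_eventuallyEq hψ hμ hρ), X_kernel hM.inv_isSymm hδ hφ]
    simp only [hk]
    set a := R ^ (-4 : ℝ)
    set s := deriv step (phiM M w / R ^ 4)
    set p := phiM M w ^ (-alpha n δ - 1)
    have hs : s ≤ 0 := deriv_step_nonpos _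
    have ha : 0 < a := Real.rpow_pos_of_pos hR0 _
    have hp : 0 < p := Real.rpow_pos_of_pos hφ _
    have hpφ : phiM M w ^ (-alpha n δ) = p * phiM M w := by
      simp only [p]
      rw [Real.rpow_sub_one hφ.ne']
      field_simp
    have hsum : ∑ i, ∑ j, A i j * (a * s * gradPhi M w i * (p * gradPhi M w j)) =
        (a * s * p) * (gradPhi M w ⬝ᵥ (A *ᵥ gradPhi M w)) := by
      rw [← sum_mul_mul_eq]
      refine Finset.sum_congr rfl fun i _ => Finset.sum_congr rfl fun j _ => by ring
    rw [hsum, hpφ]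
    -- M ≤ ΛI and A ≥ λI give A ≥ (λ/Λ)M.
    have hgrad : lam / Lam * (16 * ((M⁻¹ *ᵥ w.1) ⬝ᵥ w.1) * phiM M w) ≤
        gradPhi M w ⬝ᵥ (A *ᵥ gradPhi M w) := by
      rw [← hM.form_gradPhi hS]
      calc lam / Lam * (gradPhi M w ⬝ᵥ (M *ᵥ gradPhi M w))
          ≤ lam / Lam * (Lam * (gradPhi M w ⬝ᵥ gradPhi M w)) :=
            mul_le_mul_of_nonneg_left (hM.upper _) (by positivity)
        _ = lam * (gradPhi M w ⬝ᵥ gradPhi M w) := by field_simp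
        _ ≤ _ := hA.lower _
    have hcoef : 0 ≤ a * -s * p :=
      mul_nonneg (mul_nonneg ha.le (neg_nonneg.2 hs)) hp.le
    have := mul_le_mul_of_nonneg_left hgrad hcoef
    linarith

end Heisenberg

/-! ### Comparison of gauges, distance to the boundary, and the bound for the potential. -/

namespace Heisenberg

variable {n : ℕ} {lam Lam δ μ : ℝ} {M : Matrix (Fin n ⊕ Fin n) (Fin n ⊕ Fin n) ℝ} {ψ : ℝ → ℝ}

theorem comp_inv_comp_inv (z₀ z ζ : Heis n) :
    comp (inv (comp (inv z₀) ζ)) (comp (inv z₀) z) = comp (inv ζ) z := by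
  have h1 : (Matrix.J (Fin n) ℝ *ᵥ z₀.1) ⬝ᵥ z₀.1 = 0 := by
    rw [dotProduct_comm, dotProduct_J_mulVec_self]
  have h2 : (Matrix.J (Fin n) ℝ *ᵥ z₀.1) ⬝ᵥ ζ.1 = -((Matrix.J (Fin n) ℝ *ᵥ ζ.1) ⬝ᵥ z₀.1) := by
    rw [dotProduct_comm, Matrix.dotProduct_mulVec,
      ← Matrix.mulVec_transpose, Matrix.J_transpose, Matrix.neg_mulVec, neg_dotProduct]
  simp only [comp_inv_eq]
  ext k
  · simp
  · simp only [Matrix.mulVec_sub, dotProduct_sub, sub_dotProduct, h1, h2]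
    ring

/-- A crude form of the triangle inequality, comparing the gauge of `M` to the standard one. -/
theorem phiM_comp_inv_le (hM : IsEllipticMatrix lam Lam M) (hlam : 0 < lam)
    (hS : IsSymplecticMatrix M) {z₀ z ζ : Heis n} {r : ℝ}
    (hz : z ∈ ball z₀ r) (hζ : ζ ∈ ball z₀ r) :
    phiM M (comp (inv ζ) z) ≤ 16 * (Lam ^ 2 + 1) * r ^ 4 := by
  have hp := phiM_one_lt_of_mem_ball hz
  have hq := phiM_one_lt_of_mem_ball hζ
  rw [← comp_inv_comp_inv z₀ z ζ]
  set p := comp (inv z₀) z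
  set q := comp (inv z₀) ζ
  rw [phiM_one] at hp hq
  have hr2 : 0 ≤ r ^ 2 := sq_nonneg r
  have key : ∀ {x : ℝ}, x ^ 2 ≤ r ^ 4 → |x| ≤ r ^ 2 := fun {x} h =>
    abs_le_of_sq_le_sq (by rw [← pow_mul]; exact h) hr2
  have ha : p.1 ⬝ᵥ p.1 ≤ r ^ 2 := (le_abs_self _).trans (key (by nlinarith [sq_nonneg p.2]))
  have hb : q.1 ⬝ᵥ q.1 ≤ r ^ 2 := (le_abs_self _).trans (key (by nlinarith [sq_nonneg q.2]))
  have hs : |p.2| ≤ r ^ 2 := key (by nlinarith [sq_nonneg (p.1 ⬝ᵥ p.1)])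
  have ht : |q.2| ≤ r ^ 2 := key (by nlinarith [sq_nonneg (q.1 ⬝ᵥ q.1)])
  have hJ : |(Matrix.J (Fin n) ℝ *ᵥ q.1) ⬝ᵥ p.1| ≤ r ^ 2 := by
    refine key ((IsEllipticMatrix.dotProduct_sq_le _ _).trans ?_)
    rw [J_mulVec_dotProduct_J_mulVec]
    calc _ ≤ r ^ 2 * r ^ 2 := mul_le_mul hb ha (dotProduct_self_nonneg' _) hr2
      _ = r ^ 4 := by ring
  -- Parallelogram law: |p-q|² ≤ 2|p|² + 2|q|².
  have hab : (p.1 - q.1) ⬝ᵥ (p.1 - q.1) ≤ 4 * r ^ 2 := by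
    have h := dotProduct_self_nonneg' (p.1 + q.1)
    simp only [add_dotProduct, dotProduct_add, sub_dotProduct, dotProduct_sub] at h ⊢
    linarith
  have hx := hM.inv_form_upper hS (p.1 - q.1)
  have hx0 := hM.inv_form_nonneg hlam hS (p.1 - q.1)
  have htt : |p.2 - q.2 - 2 * ((Matrix.J (Fin n) ℝ *ᵥ q.1) ⬝ᵥ p.1)| ≤ 4 * r ^ 2 := by
    rw [abs_le] at *
    constructor <;> linarith [hs.1, hs.2, ht.1, ht.2, hJ.1, hJ.2]
  rw [comp_inv_eq, phiM]
  have h1 : (M⁻¹ *ᵥ (p.1 - q.1)) ⬝ᵥ (p.1 - q.1) ≤ |Lam| * (4 * r ^ 2) :=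
    hx.trans (mul_le_mul (le_abs_self _) hab (dotProduct_self_nonneg' _) (abs_nonneg _))
  have h2 := pow_le_pow_left₀ hx0 h1 2
  have h3 := pow_le_pow_left₀ (abs_nonneg _) htt 2
  rw [sq_abs] at h3
  rw [mul_pow, sq_abs] at h2
  calc _ ≤ Lam ^ 2 * (4 * r ^ 2) ^ 2 + (4 * r ^ 2) ^ 2 := add_le_add h2 h3
    _ = _ := by ring

theorem comp_inv_comp (z v : Heis n) : comp (inv z) (comp z v) = v := by
  rw [comp_inv_eq]
  have h : (Matrix.J (Fin n) ℝ *ᵥ z.1) ⬝ᵥ z.1 = 0 := by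
    rw [dotProduct_comm, dotProduct_J_mulVec_self]
  ext k
  · simp [comp]
  · simp only [comp, dotProduct_add, h]
    ring

/-- A path from z in O to ζ outside O meets the frontier. Along s ↦ z∘(sw) with w = z⁻¹∘ζ the
distance to z is ρ(sw) ≤ ρ(w); ordinary scalar multiplication suffices, as s⁴ and s² are at most 1.
-/
theorem setDist_frontier_le {O O' : Set (Heis n)} (hO : IsOpen O) {z ζ : Heis n} (hz' : z ∈ O')
    (hz : z ∈ O) (hζ : ζ ∉ O) : setDist O' (frontier O) ≤ dist z ζ := by
  set w := comp (inv z) ζ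
  set f : ℝ → Heis n := fun s => comp z (s • w)
  have hf : Continuous f := (continuous_comp.comp (Continuous.prodMk_right z)).comp
    (continuous_id.smul continuous_const)
  have hpre : IsPreconnected (f '' Set.Icc 0 1) := isPreconnected_Icc.image f hf.continuousOn
  have hf0 : f 0 = z := by simp [f, comp]
  have hf1 : f 1 = ζ := by simp only [f, one_smul]; exact comp_inv_cancel z ζ
  obtain ⟨s, hs, hsf⟩ : ∃ s ∈ Set.Icc (0 : ℝ) 1, f s ∈ frontier O := by
    by_contra! hcon
    have hcl : ∀ s ∈ Set.Icc (0 : ℝ) 1, f s ∈ O ∨ f s ∈ (closure O)ᶜ := fun s hs => by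
      by_contra! h
      refine hcon s hs ?_
      rw [hO.frontier_eq]
      exact ⟨not_not.1 h.2, h.1⟩
    obtain ⟨v, -, hv1, hv2⟩ := hpre O (closure O)ᶜ hO isClosed_closure.isOpen_compl
      (by rintro _ ⟨s, hs, rfl⟩; exact hcl s hs)
      ⟨z, ⟨0, by simp, hf0⟩, hz⟩
      ⟨ζ, ⟨1, by simp, hf1⟩, by
        have := hcl 1 (by simp)
        rw [hf1] at this
        exact this.resolve_left hζ⟩
    exact hv2 (subset_closure hv1)
  have hbdd : BddBelow (Set.image2 dist O' (frontier O)) :=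
    ⟨0, by rintro _ ⟨a, -, b, -, rfl⟩; exact Real.rpow_nonneg (by positivity) _⟩
  refine (csInf_le hbdd ⟨z, hz', f s, hsf, rfl⟩).trans ?_
  simp only [dist, f, comp_inv_comp]
  refine Real.rpow_le_rpow (by positivity) ?_ (by norm_num)
  have h2 : s ^ 2 ≤ 1 := pow_le_one₀ hs.1 hs.2
  have h4 : s ^ 4 ≤ 1 := pow_le_one₀ hs.1 hs.2
  simp only [Prod.smul_fst, Prod.smul_snd, smul_dotProduct, dotProduct_smul, smul_eq_mul]
  calc _ = s ^ 4 * (w.1 ⬝ᵥ w.1) ^ 2 + s ^ 2 * w.2 ^ 2 := by ring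
    _ ≤ 1 * (w.1 ⬝ᵥ w.1) ^ 2 + 1 * w.2 ^ 2 :=
      add_le_add (mul_le_mul_of_nonneg_right h4 (sq_nonneg _))
        (mul_le_mul_of_nonneg_right h2 (sq_nonneg _))
    _ = _ := by ring

/-- |x|² ≤ Λ⟨M⁻¹x,x⟩ and Λ ≥ 1 give ρ ≤ √Λ ρ_M, which accounts for the √Λ in the bound on μ. -/
theorem two_mul_lt_rhoM (hn : 1 ≤ n) (hM : IsEllipticMatrix lam Lam M) (hlam : 0 < lam)
    (hLam : lam ≤ Lam) (hS : IsSymplecticMatrix M) {O O' : Set (Heis n)} (hO : IsOpen O)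
    {z ζ : Heis n} (hz' : z ∈ O') (hz : z ∈ O) (hζ : ζ ∉ O) (hμ : 0 < μ)
    (h : μ < setDist O' (frontier O) / (2 * √Lam)) : 2 * μ < rhoM M (comp (inv ζ) z) := by
  have hL1 : 1 ≤ Lam := hM.one_le hn hlam hLam hS
  have hsq : 0 < √Lam := Real.sqrt_pos.2 (by linarith)
  have hd := setDist_frontier_le hO hz' hz hζ
  rw [lt_div_iff₀ (by positivity)] at h
  have h1 : μ * (2 * √Lam) < rhoM 1 (comp (inv ζ) z) := by
    have : dist z ζ = rhoM 1 (comp (inv ζ) z) := by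
      rw [dist, rho_eq_rhoM, comp_inv_swap, rhoM, phiM_neg, rhoM]
    rw [← this]
    exact h.trans_le hd
  have h2 := pow_lt_pow_left₀ h1 (by positivity) (n := 4) (by norm_num)
  rw [rhoM_pow_four, phiM_one] at h2
  set w := comp (inv ζ) z
  have h3 := hM.dotProduct_self_le hlam hS w.1
  have h4 := pow_le_pow_left₀ (dotProduct_self_nonneg' _) h3 2
  have h5 : (μ * (2 * √Lam)) ^ 4 = (2 * μ) ^ 4 * Lam ^ 2 := by
    calc _ = (2 * μ) ^ 4 * (√Lam ^ 2) ^ 2 := by ring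
      _ = _ := by rw [Real.sq_sqrt (by linarith)]
  have h6 : w.2 ^ 2 ≤ Lam ^ 2 * w.2 ^ 2 :=
    le_mul_of_one_le_left (sq_nonneg _) (one_le_pow₀ hL1)
  have h7 : (2 * μ) ^ 4 * Lam ^ 2 < phiM M w * Lam ^ 2 := by
    rw [← h5, phiM]
    nlinarith
  refine lt_of_pow_lt_pow_left₀ 4 (rhoM_nonneg w) ?_
  rw [rhoM_pow_four]
  exact lt_of_mul_lt_mul_right h7 (sq_nonneg _)

theorem ball_subset_ball_eta (z : Heis n) {r : ℝ} (hr : 0 < r) :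
    ball z r ⊆ ball z (eta lam Lam * r) := fun ζ hζ => by
  have h : 0 ≤ √(Lam / lam) := Real.sqrt_nonneg _
  have hζ' : dist z ζ < r := hζ
  change dist z ζ < eta lam Lam * r
  unfold eta
  nlinarith

/-- The lemmas on parametric integrals need a compact domain. The frontier of O may have positive
measure, so the measure is restricted to O when passing to the closure. -/
theorem hmu_eq_integral_closure (O : Set (Heis n)) : hmu δ M ψ O μ = fun z =>
    ∫ ζ in closure O, cutKernel δ M ψ μ (comp (inv ζ) z) ∂(volume.restrict O) := by
  funext z
  rw [hmu_eq, Measure.restrict_restrict isClosed_closure.measurableSet,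
    Set.inter_eq_right.2 subset_closure]

theorem contDiff_hmu (hM : IsEllipticMatrix lam Lam M) (hlam : 0 < lam)
    (hS : IsSymplecticMatrix M) (hψ : IsCutoff ψ) (hμ : 0 < μ) {O : Set (Heis n)}
    (hO : IsCompact (closure O)) : ContDiff ℝ ∞ (hmu δ M ψ O μ) := by
  rw [hmu_eq_integral_closure]
  exact contDiff_integral_compact
    (K := fun p : Heis n × Heis n => cutKernel δ M ψ μ (comp (inv p.2) p.1)) hO
    ((contDiff_cutKernel hM hlam hS hψ hμ).comp contDiff_comp_inv)

/-- The potential dominates the cut off integral over the whole group. -/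
theorem trace_hessian_hmu_ge (hM : IsEllipticMatrix lam Lam M) (hlam : 0 < lam)
    (hS : IsSymplecticMatrix M) (hψ : IsCutoff ψ) (hμ : 0 < μ) {O : Set (Heis n)} (hO : IsOpen O)
    (hOc : IsCompact (closure O)) {A : Matrix (Fin n ⊕ Fin n) (Fin n ⊕ Fin n) ℝ}
    (hA : A.IsSymm) (hneg : ∀ w : Heis n, w ≠ 0 →
      (A * horizontalHessian (kernel δ M) w).trace ≤ 0) {z : Heis n} {R : ℝ} (hR : 0 < R)
    (hin : ∀ ζ ∈ O, phiM M (comp (inv ζ) z) ≤ R ^ 4)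
    (hout : ∀ ζ ∉ O, 2 * μ < rhoM M (comp (inv ζ) z)) :
    ∫ w : Heis n, step (phiM M w / R ^ 4) *
        (A * horizontalHessian (cutKernel δ M ψ μ) w).trace ≤
      (A * horizontalHessian (hmu δ M ψ O μ) z).trace := by
  have hR4 : 0 < R ^ 4 := by positivity
  have hk := contDiff_cutKernel (δ := δ) hM hlam hS hψ hμ
  have hT := continuous_trace_hessian hA hk
  set T := fun w => (A * horizontalHessian (cutKernel δ M ψ μ) w).trace
  have hstep : Continuous fun w : Heis n => step (phiM M w / R ^ 4) :=
    contDiff_step.continuous.comp (continuous_phiM.div_const _)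
  have hc : HasCompactSupport fun w : Heis n => step (phiM M w / R ^ 4) :=
    HasCompactSupport.intro (isCompact_phiM_le hM hlam hS (2 * R ^ 4)) fun w hw => by
      rw [Set.mem_ofPred_eq, not_le] at hw
      exact step_eq_zero ((le_div_iff₀ hR4).2 hw.le)
  have hint : Integrable fun w => step (phiM M w / R ^ 4) * T w :=
    (hstep.mul hT).integrable_of_hasCompactSupport hc.mul_right
  rw [hmu_eq_integral_closure, trace_hessian_integral hA hOc hk,
    Measure.restrict_restrict isClosed_closure.measurableSet, Set.inter_eq_right.2 subset_closure,
    ← integral_indicator hO.measurableSet]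
  -- Substitute w = ζ⁻¹∘z, so that both sides become integrals in ζ that can be compared pointwise.
  refine (integral_comp_inv (f := fun w => step (phiM M w / R ^ 4) * T w)
    (hstep.mul hT) z).ge.trans ?_
  refine integral_mono ((measurePreserving_comp_inv z).integrable_comp_of_integrable hint) ?_ ?_
  · rw [integrable_indicator_iff hO.measurableSet]
    exact (ContinuousOn.integrableOn_compact hOc
      (hT.comp (continuous_comp_inv z)).continuousOn).mono_set subset_closure
  · intro ζ
    by_cases hζ : ζ ∈ O
    · have h1 : step (phiM M (comp (inv ζ) z) / R ^ 4) = 1 :=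
        step_eq_one ((div_le_one hR4).2 (hin ζ hζ))
      simp only [Set.indicator_of_mem hζ, h1, one_mul]
      exact le_rfl
    · have h2 := hout ζ hζ
      have h0 : comp (inv ζ) z ≠ 0 := fun h0 => by
        rw [h0, rhoM, phiM_zero, Real.zero_rpow (by norm_num)] at h2
        linarith
      simp only [Set.indicator_of_notMem hζ, T]
      rw [horizontalHessian_congr (cutKernel_eventuallyEq hψ hμ h2)]
      exact mul_nonpos_of_nonneg_of_nonpos (step_nonneg _) (hneg _ h0)

end Heisenberg

/-! ### Choice of the constants and conclusion. -/

theorem mainTheorem4 (n : ℕ) (hn : 1 ≤ n) (lam Lam δ : ℝ) (hlam : 0 < lam) (hLam : lam ≤ Lam)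
    (hδ : 0 < δ) (hδ' : δ < 1 / 2) :
    ∃ C : ℝ, 0 < C ∧ ∀ om : ℝ → ℝ, Heisenberg.IsModulus om →
      (∃ ε₀ : ℝ, Heisenberg.IsSubsolutionRadius n lam Lam δ om ε₀) ∧
      ∀ ε₀ : ℝ, Heisenberg.IsSubsolutionRadius n lam Lam δ om ε₀ →
      ∀ (Ω : Set (Heisenberg.Heis n)) (r : ℝ) (z₀ : Heisenberg.Heis n)
        (O O' : Set (Heisenberg.Heis n)),
        IsOpen Ω → 0 < r → r ≤ ε₀ → z₀ ∈ Ω →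
        Heisenberg.ball z₀ (Heisenberg.eta lam Lam * r) ⊆ Ω →
        IsOpen O → IsOpen O' → O ⊆ Heisenberg.ball z₀ r →
        IsCompact (closure O') → closure O' ⊆ O →
      ∀ A : Heisenberg.Coeff n, Heisenberg.IsElliptic lam Lam Ω A →
        Heisenberg.HasModulus Ω om A → Heisenberg.IsSymplectic Ω A →
      ∀ ψ : ℝ → ℝ, Heisenberg.IsCutoff ψ →
      ∀ μ : ℝ, 0 < μ →
        ContDiff ℝ ∞ (Heisenberg.hmu δ (A z₀) ψ O μ) ∧
        (μ < min (r / √lam) (Heisenberg.setDist O' (frontier O) / (2 * √Lam)) →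
          ∀ z ∈ O', C * r ^ (-4 * δ) ≤
            Heisenberg.L A (Heisenberg.hmu δ (A z₀) ψ O μ) z) := by
  open Heisenberg in
  have hL0 : 0 < Lam := hlam.trans_le hLam
  -- The first summand makes K⁴ ≥ 16(Λ²+1), so φ_M(ζ⁻¹∘z) ≤ (Kr)⁴ on the ball; the second gives 2μ <
  -- 2r/√λ ≤ Kr, through s ≤ s² + 1 with s = 1/√λ.
  set K : ℝ := 2 * (Lam + 1) + 2 * (1 / lam + 1)
  have hK : 0 < K := by positivity
  have hc := gaugeConst_pos hn (alpha n δ)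
  refine ⟨16 * (lam / Lam) * (K ^ (-4 * δ) * gaugeConst n (alpha n δ)), by positivity,
    fun om hom => ⟨exists_isSubsolutionRadius hlam hδ hom, ?_⟩⟩
  intro ε₀ hε₀ Ω r z₀ O O' hΩ hr hrε hz₀ hball hO _ hOball _ hO'O A hA hmod hS ψ hψ μ hμ
  have hM := hA.isEllipticMatrix hz₀
  have hSM := hS z₀ hz₀
  have hOc := isCompact_closure_of_subset_ball hOball
  refine ⟨contDiff_hmu hM hlam hSM hψ hμ hOc, fun hμ' z hz => ?_⟩
  have hzO : z ∈ O := hO'O (subset_closure hz)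
  have hzb : z ∈ ball z₀ r := hOball hzO
  have hzΩ : z ∈ Ω := hball (ball_subset_ball_eta z₀ hr hzb)
  have hKr : 0 < K * r := mul_pos hK hr
  have hμr : 2 * μ < K * r := by
    have h1 := (lt_min_iff.1 hμ').1
    have hs : 0 < √lam := Real.sqrt_pos.2 hlam
    have h2 : 1 / √lam ≤ 1 / lam + 1 := by
      have h3 : 1 / lam = (1 / √lam) ^ 2 := by rw [div_pow, Real.sq_sqrt hlam.le, one_pow]
      rw [h3]
      nlinarith [sq_nonneg (1 / √lam - 1 / 2)]
    calc 2 * μ < 2 * (1 / √lam) * r := by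
          rw [mul_assoc, one_div_mul_eq_div]; linarith
      _ ≤ K * r := mul_le_mul_of_nonneg_right (by simp only [K]; linarith) hr.le
  have hin : ∀ ζ ∈ O, phiM (A z₀) (comp (inv ζ) z) ≤ (K * r) ^ 4 := fun ζ hζ => by
    refine (phiM_comp_inv_le hM hlam hSM hzb (hOball hζ)).trans ?_
    rw [mul_pow]
    refine mul_le_mul_of_nonneg_right ?_ (by positivity)
    have h1 : 2 * (Lam + 1) ≤ K := by
      have : 0 < 1 / lam := by positivity
      simp only [K]; linarith
    have h2 := pow_le_pow_left₀ (by positivity) h1 4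
    nlinarith [pow_pos hL0 3, pow_pos hL0 4, pow_pos hL0 2]
  -- L_A at z involves only the matrix A(z), so the constant coefficient estimates apply with A(z)
  -- frozen.
  have hmain := (integral_step_mul_trace_hessian_ge hM hlam hLam hSM hδ
    (hA.isEllipticMatrix hzΩ) hψ hμ hμr).trans
    (trace_hessian_hmu_ge hM hlam hSM hψ hμ hO hOc (hA z hzΩ).1 (fun w hw => by
      have h := hε₀.2 Ω A z₀ hΩ hA hmod hz₀ hSM z ⟨lt_of_lt_of_le hzb hrε, hzΩ⟩ w hw
      linarith) hKr hin
      fun ζ hζ => two_mul_lt_rhoM hn hM hlam hLam hSM hO hz hzO hζ hμ (lt_min_iff.1 hμ').2)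
  rw [Real.mul_rpow hK.le hr.le] at hmain
  calc _ = _ := by ring
    _ ≤ _ := hmain
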